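/- Let $\Bbbk$ be a field, $A$ an associative unital $\Bbbk$-algebra, and $\Gamma \subseteq A$ a unital subalgebra. Let $\mathrm{cfs}(\Gamma)$ be the set of maximal two-sided ideals of $\Gamma$ of finite codimension, and let $\sim$ be an arbitrary equivalence relation on $\mathrm{cfs}(\Gamma)$; its classes are called blocks. For a block $B$ let $\langle B\rangle$ be the set of all finite products $\mathfrak{m}_1\cdots\mathfrak{m}_k$ ($k\ge 0$, the empty product being $\Gamma$) with $\mathfrak{m}_i\in B$. For a left $\Gamma$-module $V$ put $V(B)=\{v\in V:\mathfrak{m}v=0\text{ for some }\mathfrak{m}\in\langle B\rangle\}$. Call $V$ a block module if $V=\bigoplus_{B}V(B)$, and a strong block module if moreover for every block $B$ there is $\mathfrak{m}\in\langle B\rangle$ with $\mathfrak{m}V(B)=0$; similarly for right modules. Let $\mathrm{HC}(A;\Gamma,\sim)$ (resp. $\mathrm{SHC}(A;\Gamma,\sim)$) be the full subcategory of the category of left $A$-modules whose objects are block modules (resp. strong block modules) over $\Gamma$. Assume that $\Gamma$ is a strong Harish-Chandra block subalgebra of $A$: for every block $B$ and every $\mathfrak{m}\in\langle B\rangle$,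 the left module $A/A\mathfrak{m}$ and the right module $A/\mathfrak{m}A$ are strong block modules over $\Gamma$. Let $\mathcal{A}$ be the category whose objects are the blocks, with $$\mathcal{A}(B,C)=\varprojlim_{\mathfrak{m}\in\langle B\rangle,\ \mathfrak{n}\in\langle C\rangle}\frac{A}{\mathfrak{n}A+A\mathfrak{m}},$$ and with the following composition. Given $\alpha\in\mathcal{A}(B,C)$, $\beta\in\mathcal{A}(C,D)$, $\mathfrak{m}\in\langle B\rangle$ and $\mathfrak{l}\in\langle D\rangle$, choose $\mathfrak{n}\in\langle C\rangle$ annihilating both $(A/A\mathfrak{m})(C)$ and $(A/\mathfrak{l}A)(C)$, and choose $a_0,b_0\in A$ such that $\alpha_{\mathfrak{m},\mathfrak{n}}=a_0+\mathfrak{n}A+A\mathfrak{m}$, $a_0+A\mathfrak{m}\in(A/A\mathfrak{m})(C)$, $\beta_{\mathfrak{n},\mathfrak{l}}=b_0+\mathfrak{l}A+A\mathfrak{n}$ and $b_0+\mathfrak{l}A\in(A/\mathfrak{l}A)(C)$. Then $(\beta\circ\alpha)_{\mathfrak{m},\mathfrak{l}}=b_0a_0+\mathfrak{l}A+A\mathfrak{m}$,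 which does not depend on the choices. The identity of $B$ is the image of $1\in A$. Give $\mathcal{A}(B,C)$ the limit topology, each $A/(\mathfrak{n}A+A\mathfrak{m})$ being discrete. A profinite (resp. discrete) $\mathcal{A}$-module is a functor $F$ from $\mathcal{A}$ to the category of $\Bbbk$-vector spaces such that every map $F_{B,C}:\mathcal{A}(B,C)\to\mathrm{Hom}_\Bbbk(F(B),F(C))$ is $\Bbbk$-linear and continuous, where $\mathrm{Hom}_\Bbbk(F(B),F(C))$ carries the limit topology of $\varprojlim_U\mathrm{Hom}_\Bbbk(U,F(C))$, with $U$ running over the finite-dimensional subspaces of $F(B)$ and each $\mathrm{Hom}_\Bbbk(U,F(C))$ discrete (resp. where it carries the discrete topology). Let ${}_{\mathcal{A}}^{\mathrm{pf}}\mathbf{Mod}$ and ${}_{\mathcal{A}}^{\mathrm{ds}}\mathbf{Mod}$ be the corresponding full subcategories of the category of functors and natural transformations. Then there are equivalences of categories: (i) ${}_{\mathcal{A}}^{\mathrm{pf}}\mathbf{Mod}\simeq\mathrm{HC}(A;\Gamma,\sim)$; (ii) ${}_{\mathcal{A}}^{\mathrm{ds}}\mathbf{Mod}\simeq\mathrm{SHC}(A;\Gamma,\sim)$.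 -/

import Mathlib

universe u v w

open CategoryTheory

namespace HarishChandra

section Blocks

/-- `cfs(G)`: the maximal two-sided ideals of the `k`-algebra `G` of finite codimension. -/
structure Cfs (k : Type u) (G : Type v) [Field k] [Ring G] [Algebra k G] where
  ideal : TwoSidedIdeal G
  isMaximal : IsCoatom ideal
  finite : Module.Finite k (G ⧸ ideal.asIdeal)

variable {k : Type u} [Field k] {G : Type v} [Ring G] [Algebra k G]

/-- The product ideal `𝔪₁ ⋯ 𝔪ₖ` of a list of elements of `cfs(G)`; the empty product is `G`. -/
def wordIdeal : List (Cfs k G) → Ideal G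
  | [] => ⊤
  | m :: l => m.ideal.asIdeal * wordIdeal l

/-- The blocks: the equivalence classes `cfs(G)/∼`. -/
abbrev Blocks (r : Setoid (Cfs k G)) : Type v := Quotient r

/-- The set of all finite products `𝔪₁ ⋯ 𝔪ₖ` (`k ≥ 0`) of members of the block `B`. -/
def words (r : Setoid (Cfs k G)) (B : Blocks r) : Set (Ideal G) :=
  {I | ∃ l : List (Cfs k G), (∀ m ∈ l, (Quotient.mk r m : Blocks r) = B) ∧ wordIdeal l = I}

instance wordIdeal_isTwoSided : (l : List (Cfs k G)) → (wordIdeal l).IsTwoSided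
  | [] => (inferInstance : (⊤ : Ideal G).IsTwoSided)
  | m :: l => by
    have := wordIdeal_isTwoSided l
    exact (inferInstance : (m.ideal.asIdeal * wordIdeal l).IsTwoSided)

variable {r : Setoid (Cfs k G)}

theorem words_mul_mem {B : Blocks r} {I : Ideal G} (hI : I ∈ words r B) {x : G} (hx : x ∈ I)
    (y : G) : x * y ∈ I := by
  obtain ⟨l, -, rfl⟩ := hI
  exact Ideal.mul_mem_right y _ hx

theorem top_mem_words (B : Blocks r) : (⊤ : Ideal G) ∈ words r B := ⟨[], by simp, rfl⟩

theorem wordIdeal_append_le (l l' : List (Cfs k G)) :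
    wordIdeal (l ++ l') ≤ wordIdeal l ∧ wordIdeal (l ++ l') ≤ wordIdeal l' := by
  induction l with
  | nil => exact ⟨le_top, le_rfl⟩
  | cons m l ih =>
    exact ⟨Ideal.mul_mono_right ih.1, Ideal.mul_le_right.trans ih.2⟩

theorem words_directed {B : Blocks r} {I J : Ideal G} (hI : I ∈ words r B) (hJ : J ∈ words r B) :
    ∃ K ∈ words r B, K ≤ I ∧ K ≤ J := by
  obtain ⟨l, hl, rfl⟩ := hI
  obtain ⟨l', hl', rfl⟩ := hJ
  refine ⟨_, ⟨l ++ l', ?_, rfl⟩, wordIdeal_append_le l l'⟩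
  intro m hm
  rcases List.mem_append.1 hm with h | h
  exacts [hl m h, hl' m h]

theorem exists_add_eq_one_mul {I J K : Ideal G} [J.IsTwoSided]
    (hJ : ∃ x ∈ I, ∃ y ∈ J, x + y = 1) (hK : ∃ x ∈ I, ∃ y ∈ K, x + y = 1)
    (hI : ∀ x ∈ I, ∀ y, x * y ∈ I) : ∃ x ∈ I, ∃ y ∈ J * K, x + y = 1 := by
  obtain ⟨x, hx, y, hy, h⟩ := hJ
  obtain ⟨x', hx', y', hy', h'⟩ := hK
  refine ⟨x * (x' + y') + y * x', ?_, y * y', Ideal.mul_mem_mul hy hy', ?_⟩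
  · exact I.add_mem (hI x hx _) (I.mul_mem_left _ hx')
  · rw [add_assoc, ← mul_add, ← add_mul, h, h', one_mul]

theorem cfs_comaximal (m n : Cfs k G) (h : m ≠ n) :
    ∃ x ∈ m.ideal.asIdeal, ∃ y ∈ n.ideal.asIdeal, x + y = 1 := by
  have hne : m.ideal ≠ n.ideal := by
    intro e
    apply h
    cases m; cases n; congr
  have htop : m.ideal ⊔ n.ideal = ⊤ := by
    by_contra hc
    have h1 : m.ideal = m.ideal ⊔ n.ideal :=
      (m.isMaximal.le_iff.1 le_sup_left).resolve_left hc |>.symm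
    have h2 : n.ideal = m.ideal ⊔ n.ideal :=
      (n.isMaximal.le_iff.1 le_sup_right).resolve_left hc |>.symm
    exact hne (h1.trans h2.symm)
  have h1 : (1 : G) ∈ m.ideal ⊔ n.ideal := by rw [htop]; trivial
  obtain ⟨x, hx, y, hy, e⟩ := TwoSidedIdeal.mem_sup.1 h1
  exact ⟨x, TwoSidedIdeal.mem_asIdeal.2 hx, y, TwoSidedIdeal.mem_asIdeal.2 hy, e⟩

theorem words_comaximal {B C : Blocks r} (hBC : B ≠ C) {I J : Ideal G}
    (hI : I ∈ words r B) (hJ : J ∈ words r C) : ∃ x ∈ I, ∃ y ∈ J, x + y = 1 := by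
  obtain ⟨l, hl, rfl⟩ := hI
  obtain ⟨l', hl', rfl⟩ := hJ
  have key : ∀ m : Cfs k G, (Quotient.mk r m : Blocks r) = B →
      ∃ x ∈ m.ideal.asIdeal, ∃ y ∈ wordIdeal l', x + y = 1 := by
    intro m hm
    clear hl
    induction l' with
    | nil => exact ⟨0, Ideal.zero_mem _, 1, trivial, zero_add 1⟩
    | cons n l' ih =>
      refine exists_add_eq_one_mul (cfs_comaximal m n ?_)
        (ih fun x hx => hl' x (List.mem_cons_of_mem _ hx)) ?_
      · rintro rfl
        exact hBC (hm.symm.trans (hl' m List.mem_cons_self))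
      · exact fun x hx y => Ideal.mul_mem_right y _ hx
  have flip : ∀ {I J : Ideal G}, (∃ x ∈ I, ∃ y ∈ J, x + y = 1) →
      ∃ x ∈ J, ∃ y ∈ I, x + y = 1 := by
    rintro I J ⟨x, hx, y, hy, h⟩
    exact ⟨y, hy, x, hx, by rw [add_comm, h]⟩
  apply flip
  induction l with
  | nil => exact ⟨0, Ideal.zero_mem _, 1, trivial, zero_add 1⟩
  | cons m l ih =>
    refine exists_add_eq_one_mul (flip (key m (hl m List.mem_cons_self)))
      (ih fun x hx => hl x (List.mem_cons_of_mem _ hx)) ?_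
    exact fun x hx y => Ideal.mul_mem_right y _ hx

variable (r)

/-- The block space `V(B) = {v : 𝔪 v = 0 for some product 𝔪 of members of B}` of a left
`G`-module `V`. -/
def blockSpace (V : Type w) [AddCommGroup V] [Module G V] (B : Blocks r) : Submodule G V where
  carrier := {v | ∃ I ∈ words r B, ∀ x ∈ I, x • v = 0}
  zero_mem' := ⟨⊤, top_mem_words B, fun x _ => smul_zero x⟩
  add_mem' := by
    rintro v v' ⟨I, hI, h⟩ ⟨J, hJ, h'⟩
    obtain ⟨K, hK, h1, h2⟩ := words_directed hI hJ
    exact ⟨K, hK, fun x hx => by rw [smul_add, h x (h1 hx), h' x (h2 hx), add_zero]⟩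
  smul_mem' := by
    rintro g v ⟨I, hI, h⟩
    exact ⟨I, hI, fun x hx => by rw [← mul_smul]; exact h _ (words_mul_mem hI hx g)⟩

/-- The block space `W(B) = {w : w 𝔪 = 0 for some product 𝔪 of members of B}` of a right
`G`-module `W`. -/
def rightBlockSpace (W : Type w) [AddCommGroup W] [Module Gᵐᵒᵖ W] (B : Blocks r) :
    Submodule Gᵐᵒᵖ W where
  carrier := {v | ∃ I ∈ words r B, ∀ x ∈ I, MulOpposite.op x • v = 0}
  zero_mem' := ⟨⊤, top_mem_words B, fun x _ => smul_zero _⟩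
  add_mem' := by
    rintro v v' ⟨I, hI, h⟩ ⟨J, hJ, h'⟩
    obtain ⟨K, hK, h1, h2⟩ := words_directed hI hJ
    exact ⟨K, hK, fun x hx => by rw [smul_add, h x (h1 hx), h' x (h2 hx), add_zero]⟩
  smul_mem' := by
    rintro g v ⟨I, hI, h⟩
    exact ⟨I, hI, fun x hx => by rw [← mul_smul]; exact h _ (I.mul_mem_left g.unop hx)⟩

open Classical in
/-- A left `G`-module is a block module if it is the direct sum of its block spaces. -/
def IsBlockModule (V : Type w) [AddCommGroup V] [Module G V] : Prop :=
  DirectSum.IsInternal fun B : Blocks r => blockSpace r V B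

/-- A strong block module: a block module each block space of which is annihilated by a single
finite product of members of the block. -/
def IsStrongBlockModule (V : Type w) [AddCommGroup V] [Module G V] : Prop :=
  IsBlockModule r V ∧
    ∀ B : Blocks r, ∃ I ∈ words r B, ∀ x ∈ I, ∀ v ∈ blockSpace r V B, x • v = 0

open Classical in
/-- Block modules, for right modules. -/
def IsRightBlockModule (W : Type w) [AddCommGroup W] [Module Gᵐᵒᵖ W] : Prop :=
  DirectSum.IsInternal fun B : Blocks r => rightBlockSpace r W B

/-- Strong block modules, for right modules. -/
def IsStrongRightBlockModule (W : Type w) [AddCommGroup W] [Module Gᵐᵒᵖ W] : Prop :=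
  IsRightBlockModule r W ∧
    ∀ B : Blocks r, ∃ I ∈ words r B, ∀ x ∈ I, ∀ v ∈ rightBlockSpace r W B,
      MulOpposite.op x • v = 0

end Blocks

section Subalgebra

variable {k : Type u} [Field k] {A : Type v} [Ring A] [Algebra k A] (Γ : Subalgebra k A)

/-- The left ideal `A𝔪` of `A`. -/
def leftIdeal (I : Ideal Γ) : Submodule A A := Submodule.span A (Γ.val '' (I : Set Γ))

/-- The right ideal `𝔫A` of `A`. -/
def rightIdeal (I : Ideal Γ) : Submodule Aᵐᵒᵖ A := Submodule.span Aᵐᵒᵖ (Γ.val '' (I : Set Γ))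

/-- A right `A`-module regarded as a right `Γ`-module. -/
abbrev restrictRight (W : Type w) [AddCommGroup W] [Module Aᵐᵒᵖ W] : Module (Γ)ᵐᵒᵖ W :=
  Module.compHom W (RingHom.op (Γ.val : Γ →+* A))

/-- `Γ` is a strong Harish-Chandra block subalgebra of `A` with respect to `∼`: for every product
`𝔪` of members of a block, the left module `A/A𝔪` and the right module `A/𝔪A` are strong block
modules over `Γ`. -/
def IsStrongHCBlockSubalgebra (r : Setoid (Cfs k Γ)) : Prop :=
  (∀ B : Blocks r, ∀ I ∈ words r B, IsStrongBlockModule r (A ⧸ leftIdeal Γ I)) ∧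
    ∀ B : Blocks r, ∀ I ∈ words r B,
      letI := restrictRight Γ (A ⧸ rightIdeal Γ I)
      IsStrongRightBlockModule r (A ⧸ rightIdeal Γ I)

/-- The subspace `𝔫A + A𝔪` of `A`. -/
def cosetSpace (J I : Ideal Γ) : Submodule k A :=
  (rightIdeal Γ J).restrictScalars k ⊔ (leftIdeal Γ I).restrictScalars k

variable {Γ}

theorem leftIdeal_mono {I I' : Ideal Γ} (h : I' ≤ I) : leftIdeal Γ I' ≤ leftIdeal Γ I :=
  Submodule.span_mono (Set.image_mono h)

theorem rightIdeal_mono {I I' : Ideal Γ} (h : I' ≤ I) : rightIdeal Γ I' ≤ rightIdeal Γ I :=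
  Submodule.span_mono (Set.image_mono h)

theorem cosetSpace_mono {J J' I I' : Ideal Γ} (hJ : J' ≤ J) (hI : I' ≤ I) :
    cosetSpace Γ J' I' ≤ cosetSpace Γ J I :=
  sup_le_sup (rightIdeal_mono hJ) (leftIdeal_mono hI)

theorem mul_mem_leftIdeal {I : Ideal Γ} (a : A) {x : Γ} (hx : x ∈ I) :
    a * (x : A) ∈ leftIdeal Γ I :=
  (leftIdeal Γ I).smul_mem a (Submodule.subset_span ⟨x, hx, rfl⟩)

theorem mul_mem_rightIdeal {I : Ideal Γ} {x : Γ} (hx : x ∈ I) (a : A) :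
    (x : A) * a ∈ rightIdeal Γ I :=
  (rightIdeal Γ I).smul_mem (MulOpposite.op a) (Submodule.subset_span ⟨x, hx, rfl⟩)

theorem left_mem_cosetSpace {J I : Ideal Γ} {a : A} (h : a ∈ leftIdeal Γ I) :
    a ∈ cosetSpace Γ J I :=
  (le_sup_right : (leftIdeal Γ I).restrictScalars k ≤ cosetSpace Γ J I) h

theorem right_mem_cosetSpace {J I : Ideal Γ} {a : A} (h : a ∈ rightIdeal Γ J) :
    a ∈ cosetSpace Γ J I :=
  (le_sup_left : (rightIdeal Γ J).restrictScalars k ≤ cosetSpace Γ J I) h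

/-- If `b 𝔫 ⊆ 𝔩A`, then `b (𝔫A + A𝔪) ⊆ 𝔩A + A𝔪`. -/
theorem mul_mem_cosetSpace_left {L J I : Ideal Γ} {b : A}
    (hb : ∀ x ∈ J, b * (x : A) ∈ rightIdeal Γ L) {c : A} (hc : c ∈ cosetSpace Γ J I) :
    b * c ∈ cosetSpace Γ L I := by
  obtain ⟨c₁, h₁, c₂, h₂, rfl⟩ := Submodule.mem_sup.1 hc
  rw [mul_add]
  refine add_mem (right_mem_cosetSpace ?_)
    (left_mem_cosetSpace ((leftIdeal Γ I).smul_mem b h₂))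
  replace h₁ : c₁ ∈ rightIdeal Γ J := h₁
  clear hc
  induction h₁ using Submodule.span_induction with
  | mem x hx =>
    obtain ⟨x, hx, rfl⟩ := hx
    exact hb x hx
  | zero => rw [mul_zero]; exact zero_mem _
  | add x y _ _ hx hy => rw [mul_add]; exact add_mem hx hy
  | smul a x _ hx =>
    have : b * (a • x) = a • (b * x) := (mul_assoc b x a.unop).symm
    rw [this]; exact (rightIdeal Γ L).smul_mem a hx

/-- If `𝔫 a ⊆ A𝔪`, then `(𝔩A + A𝔫) a ⊆ 𝔩A + A𝔪`. -/
theorem mul_mem_cosetSpace_right {L J I : Ideal Γ} {a : A}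
    (ha : ∀ x ∈ J, (x : A) * a ∈ leftIdeal Γ I) {c : A} (hc : c ∈ cosetSpace Γ L J) :
    c * a ∈ cosetSpace Γ L I := by
  obtain ⟨c₁, h₁, c₂, h₂, rfl⟩ := Submodule.mem_sup.1 hc
  rw [add_mul]
  refine add_mem (right_mem_cosetSpace ((rightIdeal Γ L).smul_mem (MulOpposite.op a) h₁))
    (left_mem_cosetSpace ?_)
  replace h₂ : c₂ ∈ leftIdeal Γ J := h₂
  clear hc
  induction h₂ using Submodule.span_induction with
  | mem x hx =>
    obtain ⟨x, hx, rfl⟩ := hx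
    exact ha x hx
  | zero => rw [zero_mul]; exact zero_mem _
  | add x y _ _ hx hy => rw [add_mul]; exact add_mem hx hy
  | smul b x _ hx =>
    have : (b • x) * a = b • (x * a) := mul_assoc b x a
    rw [this]; exact (leftIdeal Γ I).smul_mem b hx

variable {r : Setoid (Cfs k Γ)}

variable (r) in
/-- `a + A𝔪` lies in the block space `(A/A𝔪)(C)`. -/
def LeftRep (I : Ideal Γ) (C : Blocks r) (a : A) : Prop :=
  ((leftIdeal Γ I).mkQ a) ∈ blockSpace r (A ⧸ leftIdeal Γ I) C

variable (r) in
/-- `b + 𝔩A` lies in the block space `(A/𝔩A)(C)` of the right module `A/𝔩A`. -/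
def RightRep (L : Ideal Γ) (C : Blocks r) (b : A) : Prop :=
  letI := restrictRight Γ (A ⧸ rightIdeal Γ L)
  ((rightIdeal Γ L).mkQ b) ∈ rightBlockSpace r (A ⧸ rightIdeal Γ L) C

theorem leftRep_iff {I : Ideal Γ} {C : Blocks r} {a : A} :
    LeftRep r I C a ↔ ∃ J ∈ words r C, ∀ x ∈ J, (x : A) * a ∈ leftIdeal Γ I := by
  refine exists_congr fun J => and_congr_right fun _ => forall₂_congr fun x _ => ?_
  exact Submodule.Quotient.mk_eq_zero (leftIdeal Γ I) (x := (x : A) * a)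

theorem rightRep_iff {L : Ideal Γ} {C : Blocks r} {b : A} :
    RightRep r L C b ↔ ∃ J ∈ words r C, ∀ x ∈ J, b * (x : A) ∈ rightIdeal Γ L := by
  refine exists_congr fun J => and_congr_right fun _ => forall₂_congr fun x _ => ?_
  exact Submodule.Quotient.mk_eq_zero (rightIdeal Γ L) (x := b * (x : A))

variable (r) in
/-- `𝔫` annihilates the block spaces `(A/A𝔪)(C)` and `(A/𝔩A)(C)`. Equivalently, the canonical maps
`(A/A𝔪)(C) → A/(𝔫A + A𝔪)` and `(A/𝔩A)(C) → A/(𝔩A + A𝔫)` are isomorphisms. -/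
def Adapted (L I : Ideal Γ) (C : Blocks r) (J : Ideal Γ) : Prop :=
  (∀ a, LeftRep r I C a → ∀ x ∈ J, (x : A) * a ∈ leftIdeal Γ I) ∧
    ∀ b, RightRep r L C b → ∀ x ∈ J, b * (x : A) ∈ rightIdeal Γ L

theorem Adapted.mono {L I : Ideal Γ} {C : Blocks r} {J J' : Ideal Γ} (h : Adapted r L I C J)
    (hJ : J' ≤ J) : Adapted r L I C J' :=
  ⟨fun a ha x hx => h.1 a ha x (hJ hx), fun b hb x hx => h.2 b hb x (hJ hx)⟩

theorem exists_adapted (h : IsStrongHCBlockSubalgebra Γ r) {B C D : Blocks r} {L I : Ideal Γ}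
    (hL : L ∈ words r D) (hI : I ∈ words r B) : ∃ J ∈ words r C, Adapted r L I C J := by
  obtain ⟨J₁, hJ₁, h₁⟩ := (h.1 B I hI).2 C
  obtain ⟨J₂, hJ₂, h₂⟩ := (h.2 D L hL).2 C
  obtain ⟨J, hJ, hle₁, hle₂⟩ := words_directed hJ₁ hJ₂
  refine ⟨J, hJ, fun a ha x hx => ?_, fun b hb x hx => ?_⟩
  · exact (Submodule.Quotient.mk_eq_zero (leftIdeal Γ I) (x := (x : A) * a)).1
      (h₁ x (hle₁ hx) _ ha)
  · exact (Submodule.Quotient.mk_eq_zero (rightIdeal Γ L) (x := b * (x : A))).1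
      (h₂ x (hle₂ hx) _ hb)

theorem LeftRep.add {I : Ideal Γ} {C : Blocks r} {a a' : A} (h : LeftRep r I C a)
    (h' : LeftRep r I C a') : LeftRep r I C (a + a') := by
  unfold LeftRep; rw [map_add]; exact add_mem h h'

theorem RightRep.add {I : Ideal Γ} {C : Blocks r} {a a' : A} (h : RightRep r I C a)
    (h' : RightRep r I C a') : RightRep r I C (a + a') := by
  unfold RightRep; rw [map_add]; exact Submodule.add_mem _ h h'

theorem leftRep_zero {I : Ideal Γ} {C : Blocks r} : LeftRep r I C (0 : A) := by
  unfold LeftRep; rw [map_zero]; exact zero_mem _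

theorem rightRep_zero {I : Ideal Γ} {C : Blocks r} : RightRep r I C (0 : A) := by
  unfold RightRep; rw [map_zero]; exact Submodule.zero_mem _

theorem exists_leftRep (h : IsStrongHCBlockSubalgebra Γ r) {B C : Blocks r} {J I : Ideal Γ}
    (hI : I ∈ words r B) (hJ : J ∈ words r C) (a : A) :
    ∃ a₀, LeftRep r I C a₀ ∧ a - a₀ ∈ cosetSpace Γ J I := by
  classical
  have htop := (h.1 B I hI).1.submodule_iSup_eq_top
  have key : ∀ v : A ⧸ leftIdeal Γ I, ∀ a, (leftIdeal Γ I).mkQ a = v →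
      ∃ a₀, LeftRep r I C a₀ ∧ a - a₀ ∈ cosetSpace Γ J I := by
    intro v
    have hv : v ∈ ⨆ P : Blocks r, blockSpace r (A ⧸ leftIdeal Γ I) P := by
      rw [htop]; trivial
    induction hv using Submodule.iSup_induction' with
    | mem P v hv =>
      rintro a rfl
      by_cases hP : P = C
      · subst hP
        exact ⟨a, hv, by rw [sub_self]; exact zero_mem _⟩
      · refine ⟨0, leftRep_zero, ?_⟩
        obtain ⟨K, hK, hKa⟩ := leftRep_iff.1 hv
        obtain ⟨x, hx, y, hy, hxy⟩ := words_comaximal (Ne.symm hP) hJ hK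
        have e : a - 0 = (x : A) * a + (y : A) * a := by
          rw [← add_mul, ← Subalgebra.coe_add, hxy, Subalgebra.coe_one, one_mul, sub_zero]
        rw [e]
        exact add_mem (right_mem_cosetSpace (mul_mem_rightIdeal hx a))
          (left_mem_cosetSpace (hKa y hy))
    | zero =>
      intro a ha
      refine ⟨0, leftRep_zero, left_mem_cosetSpace ?_⟩
      rw [sub_zero]
      exact (Submodule.Quotient.mk_eq_zero _).1 ha
    | add v v' _ _ hv hv' =>
      intro a ha
      obtain ⟨c, rfl⟩ := (leftIdeal Γ I).mkQ_surjective v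
      obtain ⟨a₀, h₀, h₀'⟩ := hv c rfl
      obtain ⟨a₁, h₁, h₁'⟩ := hv' (a - c) (by rw [map_sub, ha, add_sub_cancel_left])
      refine ⟨a₀ + a₁, h₀.add h₁, ?_⟩
      have : a - (a₀ + a₁) = (c - a₀) + (a - c - a₁) := by abel
      rw [this]; exact add_mem h₀' h₁'
  exact key _ a rfl

theorem exists_rightRep (h : IsStrongHCBlockSubalgebra Γ r) {C D : Blocks r} {L J : Ideal Γ}
    (hL : L ∈ words r D) (hJ : J ∈ words r C) (b : A) :
    ∃ b₀, RightRep r L C b₀ ∧ b - b₀ ∈ cosetSpace Γ L J := by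
  classical
  let _ := restrictRight Γ (A ⧸ rightIdeal Γ L)
  have htop := DirectSum.IsInternal.submodule_iSup_eq_top (h.2 D L hL).1
  have key : ∀ v : A ⧸ rightIdeal Γ L, ∀ b, (rightIdeal Γ L).mkQ b = v →
      ∃ b₀, RightRep r L C b₀ ∧ b - b₀ ∈ cosetSpace Γ L J := by
    intro v
    have hv : v ∈ ⨆ P : Blocks r, rightBlockSpace r (A ⧸ rightIdeal Γ L) P := by
      rw [htop]; trivial
    induction hv using Submodule.iSup_induction' with
    | mem P v hv =>
      rintro b rfl
      by_cases hP : P = C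
      · subst hP
        exact ⟨b, hv, by rw [sub_self]; exact zero_mem _⟩
      · refine ⟨0, rightRep_zero, ?_⟩
        obtain ⟨K, hK, hKb⟩ := rightRep_iff.1 hv
        obtain ⟨x, hx, y, hy, hxy⟩ := words_comaximal (Ne.symm hP) hJ hK
        have e : b - 0 = b * (x : A) + b * (y : A) := by
          rw [← mul_add, ← Subalgebra.coe_add, hxy, Subalgebra.coe_one, mul_one, sub_zero]
        rw [e]
        exact add_mem (left_mem_cosetSpace (mul_mem_leftIdeal b hx))
          (right_mem_cosetSpace (hKb y hy))
    | zero =>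
      intro b hb
      refine ⟨0, rightRep_zero, right_mem_cosetSpace ?_⟩
      rw [sub_zero]
      exact (Submodule.Quotient.mk_eq_zero _).1 hb
    | add v v' _ _ hv hv' =>
      intro b hb
      obtain ⟨c, rfl⟩ := (rightIdeal Γ L).mkQ_surjective v
      obtain ⟨b₀, h₀, h₀'⟩ := hv c rfl
      obtain ⟨b₁, h₁, h₁'⟩ := hv' (b - c) (by rw [map_sub, hb, add_sub_cancel_left])
      refine ⟨b₀ + b₁, h₀.add h₁, ?_⟩
      have : b - (b₀ + b₁) = (c - b₀) + (b - c - b₁) := by abel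
      rw [this]; exact add_mem h₀' h₁'
  exact key _ b rfl

/-- The product `b a` modulo `𝔩A + A𝔪` does not depend on the choice of `𝔫` and of the
representatives `a` and `b`. -/
theorem mul_sub_mul_mem {L I : Ideal Γ} {C : Blocks r} {J : Ideal Γ} (hJ : Adapted r L I C J)
    {a a' b b' : A} (ha' : LeftRep r I C a') (hb : RightRep r L C b)
    (haa : a' - a ∈ cosetSpace Γ J I) (hbb : b' - b ∈ cosetSpace Γ L J) :
    b' * a' - b * a ∈ cosetSpace Γ L I := by
  have e : b' * a' - b * a = (b' - b) * a' + b * (a' - a) := by noncomm_ring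
  rw [e]
  exact add_mem (mul_mem_cosetSpace_right (hJ.1 a' ha') hbb)
    (mul_mem_cosetSpace_left (hJ.2 b hb) haa)

end Subalgebra

section BlockCategory

variable {k : Type u} [Field k] {A : Type v} [Ring A] [Algebra k A] {Γ : Subalgebra k A}

/-- The inverse limit `𝒜(B, C) = lim A/(𝔫A + A𝔪)` over the products `𝔪` of members of `B` and `𝔫`
of members of `C` (ordered by reverse inclusion), as the space of compatible families. -/
def limHom (r : Setoid (Cfs k Γ)) (B C : Blocks r) :
    Submodule k (∀ (I : words r B) (J : words r C), A ⧸ cosetSpace Γ J.1 I.1) where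
  carrier := {α | ∀ (I I' : words r B) (J J' : words r C) (hI : I'.1 ≤ I.1) (hJ : J'.1 ≤ J.1),
    Submodule.factor (cosetSpace_mono hJ hI) (α I' J') = α I J}
  zero_mem' := fun _ _ _ _ _ _ => map_zero _
  add_mem' := fun {α β} hα hβ I I' J J' hI hJ => by
    simp only [Pi.add_apply, map_add, hα I I' J J' hI hJ, hβ I I' J J' hI hJ]
  smul_mem' := fun c α hα I I' J J' hI hJ => by
    simp only [Pi.smul_apply, map_smul, hα I I' J J' hI hJ]

/-- The limit topology on `𝒜(B, C)`: the coarsest topology for which all projections to the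
discrete spaces `A/(𝔫A + A𝔪)` are continuous. -/
instance limHomTopology (r : Setoid (Cfs k Γ)) (B C : Blocks r) :
    TopologicalSpace (limHom r B C) :=
  ⨅ (I : words r B) (J : words r C), TopologicalSpace.induced (fun α => α.1 I J) ⊥

/-- The image `(a)` of `a ∈ A` in `𝒜(B, C)`. -/
def ofElement (r : Setoid (Cfs k Γ)) (B C : Blocks r) (a : A) : limHom r B C :=
  ⟨fun I J => (cosetSpace Γ J.1 I.1).mkQ a, fun _ _ _ _ _ _ => rfl⟩

variable {r : Setoid (Cfs k Γ)} {B C D P : Blocks r}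

/-- `c` is the `(𝔪, 𝔩)` component of `β ∘ α`, as computed from an auxiliary product `𝔫` of members
of `C`: `c = b₀a₀ + 𝔩A + A𝔪` where `α_{𝔪,𝔫} = a₀ + 𝔫A + A𝔪` with `a₀ + A𝔪 ∈ (A/A𝔪)(C)` and
`β_{𝔫,𝔩} = b₀ + 𝔩A + A𝔫` with `b₀ + 𝔩A ∈ (A/𝔩A)(C)`. -/
def IsCompAt (α : limHom r B C) (β : limHom r C D) (I : words r B) (L : words r D)
    (c : A ⧸ cosetSpace Γ L.1 I.1) : Prop :=
  ∃ (J : words r C) (a₀ b₀ : A), Adapted r L.1 I.1 C J.1 ∧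
    α.1 I J = (cosetSpace Γ J.1 I.1).mkQ a₀ ∧ LeftRep r I.1 C a₀ ∧
    β.1 J L = (cosetSpace Γ L.1 J.1).mkQ b₀ ∧ RightRep r L.1 C b₀ ∧
    c = (cosetSpace Γ L.1 I.1).mkQ (b₀ * a₀)

theorem mkQ_eq_iff {S : Submodule k A} {a b : A} : S.mkQ a = S.mkQ b ↔ a - b ∈ S :=
  Submodule.Quotient.eq S

theorem limHom_factor (α : limHom r B C) {I I' : words r B} {J J' : words r C} (hI : I'.1 ≤ I.1)
    (hJ : J'.1 ≤ J.1) {a : A} (ha : α.1 I' J' = (cosetSpace Γ J'.1 I'.1).mkQ a) :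
    α.1 I J = (cosetSpace Γ J.1 I.1).mkQ a := by
  rw [← α.2 I I' J J' hI hJ, ha]; rfl

theorem exists_leftRep_eq (h : IsStrongHCBlockSubalgebra Γ r) (α : limHom r B C)
    (I : words r B) (J : words r C) :
    ∃ a, α.1 I J = (cosetSpace Γ J.1 I.1).mkQ a ∧ LeftRep r I.1 C a := by
  obtain ⟨a, ha⟩ := (cosetSpace Γ J.1 I.1).mkQ_surjective (α.1 I J)
  obtain ⟨a₀, h₀, h₁⟩ := exists_leftRep h I.2 J.2 a
  exact ⟨a₀, by rw [← ha]; exact mkQ_eq_iff.2 h₁, h₀⟩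

theorem exists_rightRep_eq (h : IsStrongHCBlockSubalgebra Γ r) (β : limHom r C D)
    (J : words r C) (L : words r D) :
    ∃ b, β.1 J L = (cosetSpace Γ L.1 J.1).mkQ b ∧ RightRep r L.1 C b := by
  obtain ⟨b, hb⟩ := (cosetSpace Γ L.1 J.1).mkQ_surjective (β.1 J L)
  obtain ⟨b₀, h₀, h₁⟩ := exists_rightRep h L.2 J.2 b
  exact ⟨b₀, by rw [← hb]; exact mkQ_eq_iff.2 h₁, h₀⟩

/-- Common refinement of finitely many choices of the auxiliary product. -/
theorem exists_adapted_le (h : IsStrongHCBlockSubalgebra Γ r) (J : words r C) (I : words r B)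
    (L : words r D) : ∃ J' : words r C, J'.1 ≤ J.1 ∧ Adapted r L.1 I.1 C J'.1 := by
  obtain ⟨K, hK, hK'⟩ := exists_adapted (C := C) h L.2 I.2
  obtain ⟨J', hJ', h₁, h₂⟩ := words_directed J.2 hK
  exact ⟨⟨J', hJ'⟩, h₁, hK'.mono h₂⟩

theorem exists_isCompAt (h : IsStrongHCBlockSubalgebra Γ r) (α : limHom r B C)
    (β : limHom r C D) (I : words r B) (L : words r D) : ∃ c, IsCompAt α β I L c := by
  obtain ⟨J, -, hJ⟩ := exists_adapted_le h ⟨⊤, top_mem_words C⟩ I L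
  obtain ⟨a, ha, ha'⟩ := exists_leftRep_eq h α I J
  obtain ⟨b, hb, hb'⟩ := exists_rightRep_eq h β J L
  exact ⟨_, J, a, b, hJ, ha, ha', hb, hb', rfl⟩

theorem IsCompAt.unique (h : IsStrongHCBlockSubalgebra Γ r) {α : limHom r B C}
    {β : limHom r C D} {I : words r B} {L : words r D} {c c' : A ⧸ cosetSpace Γ L.1 I.1}
    (hc : IsCompAt α β I L c) (hc' : IsCompAt α β I L c') : c = c' := by
  obtain ⟨J, a, b, hJ, ha, ha', hb, hb', rfl⟩ := hc
  obtain ⟨J', a₁, b₁, hJ', ha₁, ha₁', hb₁, hb₁', rfl⟩ := hc'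
  obtain ⟨K, hK, hKJ, hKJ'⟩ := words_directed J.2 J'.2
  obtain ⟨a₂, ha₂, ha₂'⟩ := exists_leftRep_eq h α I ⟨K, hK⟩
  obtain ⟨b₂, hb₂, hb₂'⟩ := exists_rightRep_eq h β ⟨K, hK⟩ L
  have key : ∀ {J : words r C} {a b : A}, Adapted r L.1 I.1 C J.1 → K ≤ J.1 →
      α.1 I J = (cosetSpace Γ J.1 I.1).mkQ a → β.1 J L = (cosetSpace Γ L.1 J.1).mkQ b →
      RightRep r L.1 C b → (cosetSpace Γ L.1 I.1).mkQ (b₂ * a₂) =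
        (cosetSpace Γ L.1 I.1).mkQ (b * a) := by
    intro J a b hJ hle ha hb hb'
    refine mkQ_eq_iff.2 (mul_sub_mul_mem hJ ha₂' hb' ?_ ?_)
    · exact mkQ_eq_iff.1 ((limHom_factor α (J := J) le_rfl hle ha₂).symm.trans ha)
    · exact mkQ_eq_iff.1 ((limHom_factor β (I := J) hle le_rfl hb₂).symm.trans hb)
  rw [← key hJ hKJ ha hb hb', ← key hJ' hKJ' ha₁ hb₁ hb₁']

theorem LeftRep.mono {I I' : Ideal Γ} (hI : I' ≤ I) {a : A} (h : LeftRep r I' C a) :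
    LeftRep r I C a := by
  obtain ⟨J, hJ, h'⟩ := leftRep_iff.1 h
  exact leftRep_iff.2 ⟨J, hJ, fun x hx => leftIdeal_mono hI (h' x hx)⟩

theorem RightRep.mono {I I' : Ideal Γ} (hI : I' ≤ I) {a : A} (h : RightRep r I' C a) :
    RightRep r I C a := by
  obtain ⟨J, hJ, h'⟩ := rightRep_iff.1 h
  exact rightRep_iff.2 ⟨J, hJ, fun x hx => rightIdeal_mono hI (h' x hx)⟩

/-- The composition `β ∘ α` in `𝒜`; its components are characterized by `IsCompAt`. -/
noncomputable def limComp (h : IsStrongHCBlockSubalgebra Γ r) (α : limHom r B C)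
    (β : limHom r C D) : limHom r B D :=
  ⟨fun I L => (exists_isCompAt h α β I L).choose, by
    intro I I' L L' hI hL
    obtain ⟨J, -, hJ⟩ := exists_adapted_le h (⟨⊤, top_mem_words C⟩ : words r C) I L
    obtain ⟨J', hle, hJ'⟩ := exists_adapted_le h J I' L'
    obtain ⟨a, ha, ha'⟩ := exists_leftRep_eq h α I' J'
    obtain ⟨b, hb, hb'⟩ := exists_rightRep_eq h β J' L'
    have h₁ := (exists_isCompAt h α β I' L').choose_spec.unique h
      ⟨J', a, b, hJ', ha, ha', hb, hb', rfl⟩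
    have h₂ := (exists_isCompAt h α β I L).choose_spec.unique h
      ⟨J', a, b, hJ.mono hle, limHom_factor α hI le_rfl ha, ha'.mono hI,
        limHom_factor β le_rfl hL hb, hb'.mono hL, rfl⟩
    exact (congrArg (Submodule.factor (cosetSpace_mono hL hI)) h₁).trans h₂.symm⟩

theorem limComp_isCompAt (h : IsStrongHCBlockSubalgebra Γ r) (α : limHom r B C)
    (β : limHom r C D) (I : words r B) (L : words r D) :
    IsCompAt α β I L ((limComp h α β).1 I L) :=
  (exists_isCompAt h α β I L).choose_spec

theorem limComp_eq (h : IsStrongHCBlockSubalgebra Γ r) {α : limHom r B C}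
    {β : limHom r C D} {I : words r B} {L : words r D} {J : words r C} {a b : A}
    (hJ : Adapted r L.1 I.1 C J.1) (ha : α.1 I J = (cosetSpace Γ J.1 I.1).mkQ a)
    (ha' : LeftRep r I.1 C a) (hb : β.1 J L = (cosetSpace Γ L.1 J.1).mkQ b)
    (hb' : RightRep r L.1 C b) :
    (limComp h α β).1 I L = (cosetSpace Γ L.1 I.1).mkQ (b * a) :=
  (limComp_isCompAt h α β I L).unique h ⟨J, a, b, hJ, ha, ha', hb, hb', rfl⟩

theorem limComp_one (h : IsStrongHCBlockSubalgebra Γ r) (α : limHom r B C) :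
    limComp h α (ofElement r C C 1) = α := by
  refine Subtype.ext (funext fun I => funext fun L => ?_)
  obtain ⟨J, hle, hJ⟩ := exists_adapted_le h L I L
  obtain ⟨a, ha, ha'⟩ := exists_leftRep_eq h α I J
  rw [limComp_eq h hJ ha ha' (b := 1) rfl
    (rightRep_iff.2 ⟨L.1, L.2, fun x hx => by
      have := mul_mem_rightIdeal hx (1 : A)
      rw [mul_one] at this
      rw [one_mul]; exact this⟩), one_mul, limHom_factor α le_rfl hle ha]

theorem one_limComp (h : IsStrongHCBlockSubalgebra Γ r) (α : limHom r B C) :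
    limComp h (ofElement r B B 1) α = α := by
  refine Subtype.ext (funext fun I => funext fun L => ?_)
  obtain ⟨J, hle, hJ⟩ := exists_adapted_le h I I L
  obtain ⟨b, hb, hb'⟩ := exists_rightRep_eq h α J L
  rw [limComp_eq h hJ (a := 1) rfl
    (leftRep_iff.2 ⟨I.1, I.2, fun x hx => by
      have := mul_mem_leftIdeal (1 : A) hx
      rw [one_mul] at this
      rw [mul_one]; exact this⟩) hb hb', mul_one, limHom_factor α hle le_rfl hb]

theorem limComp_assoc (h : IsStrongHCBlockSubalgebra Γ r) (α : limHom r B C)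
    (β : limHom r C D) (δ : limHom r D P) :
    limComp h (limComp h α β) δ = limComp h α (limComp h β δ) := by
  refine Subtype.ext (funext fun I => funext fun Q => ?_)
  obtain ⟨L, -, hL⟩ := exists_adapted_le h (⟨⊤, top_mem_words D⟩ : words r D) I Q
  obtain ⟨J₁, -, hJ₁⟩ := exists_adapted_le h (⟨⊤, top_mem_words C⟩ : words r C) I Q
  obtain ⟨J, hJle, hJ⟩ := exists_adapted_le h J₁ I L
  obtain ⟨L', hLle, hL'⟩ := exists_adapted_le h L J Q
  obtain ⟨c, hc, hc'⟩ := exists_leftRep_eq h (limComp h α β) I L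
  obtain ⟨x, hx, hx'⟩ := exists_leftRep_eq h α I J
  obtain ⟨b, hb, hb'⟩ := exists_rightRep_eq h β J L
  obtain ⟨w, hw, hw'⟩ := exists_rightRep_eq h (limComp h β δ) J Q
  obtain ⟨z, hz, hz'⟩ := exists_rightRep_eq h δ L' Q
  obtain ⟨y, hy, hy'⟩ := exists_leftRep_eq h β J L'
  rw [limComp_eq h hL hc hc' (limHom_factor δ hLle le_rfl hz) hz',
    limComp_eq h (hJ₁.mono hJle) hx hx' hw hw']
  have e₁ : c - b * x ∈ cosetSpace Γ L.1 I.1 :=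
    mkQ_eq_iff.1 (hc.symm.trans (limComp_eq h hJ hx hx' hb hb'))
  have e₂ : b - y ∈ cosetSpace Γ L.1 J.1 :=
    mkQ_eq_iff.1 (hb.symm.trans (limHom_factor β le_rfl hLle hy))
  have e₃ : z * y - w ∈ cosetSpace Γ Q.1 J.1 :=
    mkQ_eq_iff.1 ((limComp_eq h hL' hy hy' hz hz').symm.trans hw)
  refine mkQ_eq_iff.2 ?_
  have e : z * c - w * x = z * (c - b * x) + z * (b - y) * x + (z * y - w) * x := by
    noncomm_ring
  rw [e]
  refine add_mem (add_mem ?_ ?_) ?_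
  · exact mul_mem_cosetSpace_left (hL.2 z hz') e₁
  · exact mul_mem_cosetSpace_right (hJ.1 x hx') (mul_mem_cosetSpace_left (hL.2 z hz') e₂)
  · exact mul_mem_cosetSpace_right (hJ.1 x hx') e₃

/-- The objects of the category `𝒜`: the blocks `cfs(Γ)/∼`. -/
def BlockCat (Γ : Subalgebra k A) (r : Setoid (Cfs k Γ)) (_ : IsStrongHCBlockSubalgebra Γ r) :
    Type v := Blocks r

/-- The category `𝒜`, with hom-spaces the inverse limits `lim A/(𝔫A + A𝔪)`. -/
noncomputable instance blockCategory (h : IsStrongHCBlockSubalgebra Γ r) :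
    Category.{v} (BlockCat Γ r h) where
  Hom B C := limHom r B C
  id B := ofElement r B B 1
  comp α β := limComp h α β
  id_comp α := one_limComp h α
  comp_id α := limComp_one h α
  assoc α β δ := limComp_assoc h α β δ

end BlockCategory

section Modules

variable {k : Type u} [Field k]

/-- The limit topology on `Hom_k(V, W) = lim Hom_k(U, W)`, where `U` runs over the
finite-dimensional subspaces of `V` and each `Hom_k(U, W)` is discrete. -/
abbrev homLimitTopology (V W : Type w) [AddCommGroup V] [Module k V] [AddCommGroup W]
    [Module k W] : TopologicalSpace (V →ₗ[k] W) :=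
  ⨅ U : {U : Submodule k V // FiniteDimensional k U},
    TopologicalSpace.induced (fun f : V →ₗ[k] W => f.domRestrict U.1) ⊥

variable {A : Type v} [Ring A] [Algebra k A] {Γ : Subalgebra k A} {r : Setoid (Cfs k Γ)}

/-- The map `F_{B,C} : 𝒜(B, C) → Hom_k(F(B), F(C))` of a functor `F : 𝒜 ⥤ Vect_k`. -/
def functorMap {h : IsStrongHCBlockSubalgebra Γ r} (F : BlockCat Γ r h ⥤ ModuleCat.{w} k)
    (B C : BlockCat Γ r h) (α : limHom r B C) : F.obj B →ₗ[k] F.obj C :=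
  (F.map (X := B) (Y := C) α).hom

/-- A profinite `𝒜`-module: all maps `F_{B,C}` are linear and continuous for the limit topology on
`Hom_k(F(B), F(C))`. -/
def IsProfinite (h : IsStrongHCBlockSubalgebra Γ r) :
    ObjectProperty (BlockCat Γ r h ⥤ ModuleCat.{w} k) := fun F =>
  ∀ B C : BlockCat Γ r h, IsLinearMap k (functorMap F B C) ∧
    @Continuous _ _ (limHomTopology r B C) (homLimitTopology (F.obj B) (F.obj C)) (functorMap F B C)

/-- A discrete `𝒜`-module: all maps `F_{B,C}` are linear and continuous for the discrete topology
on `Hom_k(F(B), F(C))`. -/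
def IsDiscrete (h : IsStrongHCBlockSubalgebra Γ r) :
    ObjectProperty (BlockCat Γ r h ⥤ ModuleCat.{w} k) := fun F =>
  ∀ B C : BlockCat Γ r h, IsLinearMap k (functorMap F B C) ∧
    @Continuous _ _ (limHomTopology r B C) ⊥ (functorMap F B C)

/-- The category of profinite `𝒜`-modules. -/
abbrev ProfiniteMod (h : IsStrongHCBlockSubalgebra Γ r) :=
  (IsProfinite.{u, v, w} h).FullSubcategory

/-- The category of discrete `𝒜`-modules. -/
abbrev DiscreteMod (h : IsStrongHCBlockSubalgebra Γ r) :=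
  (IsDiscrete.{u, v, w} h).FullSubcategory

/-- `HC(A; Γ, ∼)`: the full subcategory of the `A`-modules that are block modules over `Γ`. -/
abbrev HC (Γ : Subalgebra k A) (r : Setoid (Cfs k Γ)) :=
  ObjectProperty.FullSubcategory fun V : ModuleCat.{w} A => IsBlockModule r V

/-- `SHC(A; Γ, ∼)`: the full subcategory of the `A`-modules that are strong block modules over
`Γ`. -/
abbrev SHC (Γ : Subalgebra k A) (r : Setoid (Cfs k Γ)) :=
  ObjectProperty.FullSubcategory fun V : ModuleCat.{w} A => IsStrongBlockModule r V

end Modules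

end HarishChandra

namespace HarishChandra

/-! ### Independence of the block spaces of a module. -/

section BlockSpaces

variable {k : Type u} [Field k] {G : Type v} [Ring G] [Algebra k G] {r : Setoid (Cfs k G)}
  {V : Type w} [AddCommGroup V] [Module G V]

/-! The equivalence sends an `A`-module `V` to `B ↦ V(B)`. Let `α ∈ 𝒜(B, C)` and let `v ∈ V(B)` be
killed by `𝔪`. If `𝔫` annihilates `(A/A𝔪)(C)`, the canonical map `(A/A𝔪)(C) → A/(𝔫A + A𝔪)` is
bijective: surjective by `exists_leftRep_eq`, injective by `LeftRep.mem_leftIdeal`. So `α_{𝔪,𝔫}` has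
a unique lift `a + A𝔪` in `(A/A𝔪)(C)`, and `α v := a v` is well defined and lies in `V(C)`.
Independence of the choices is `IsActAt.unique`; functoriality is `IsActAt.comp`.

On block modules this functor is fully faithful. Modulo `A𝔪`, every `a ∈ A` is a finite sum of
representatives lying in single blocks (`leftRep_induction`), and each of these acts on `v` as a
morphism of `𝒜`. Hence a natural transformation, summed over the blocks, is `A`-linear.

Conversely, a profinite `F` comes from `⨁ F(B)`, on which `a` acts by the matrix with entries
`F(image of a in 𝒜(B, C))`. Continuity says that each `v ∈ F(B)` sees only one component `(𝔪, 𝔫)` of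
`𝒜(B, C)`. It follows that `v` is killed by some `𝔪`, that the column of `a` at `v` is finite since
`a + A𝔪` has finitely many block components, and that the matrices multiply correctly
(`sumAct_mul`). The block spaces of the sum are the fibres, with the original action.

For the discrete case, continuity means that one pair `(𝔪, 𝔫)` serves all of `F(B)`. If one `𝔪`
kills `V(B)`, it gives such a pair; conversely, elements of `𝔪 ⊆ Γ` have zero `(𝔪, 𝔫)` component in
`𝒜(B, B)`, so such an `𝔪` kills `V(B)`. -/

theorem exists_annihilator_of_mem_iSup_blockSpace {B : Blocks r} {I : Ideal G}
    (hI : I ∈ words r B) {v : V} (hv : v ∈ ⨆ C, ⨆ _ : C ≠ B, blockSpace r V C) :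
    ∃ y : G, 1 - y ∈ I ∧ ∀ g : G, (y * g) • v = 0 := by
  have hv' : v ∈ ⨆ C : {C // C ≠ B}, blockSpace r V C.1 := by
    rwa [iSup_subtype]
  clear hv
  induction hv' using Submodule.iSup_induction' with
  | mem C v hv =>
    obtain ⟨J, hJ, h⟩ := hv
    obtain ⟨x, hx, y, hy, e⟩ := words_comaximal C.2.symm hI hJ
    refine ⟨y, ?_, fun g => h _ (words_mul_mem hJ hy g)⟩
    rwa [← e, add_sub_cancel_right]
  | zero => exact ⟨1, by simp, by simp⟩
  | add v v' _ _ hv hv' =>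
    obtain ⟨y, hy, h⟩ := hv
    obtain ⟨y', hy', h'⟩ := hv'
    refine ⟨y * y', ?_, fun g => ?_⟩
    -- `G` need not be commutative, so `y * y'` kills `v` only because `y * g` does for every `g`,
    -- in particular with `y'` in between.
    · have : 1 - y * y' = (1 - y) + y * (1 - y') := by noncomm_ring
      rw [this]
      exact I.add_mem hy (I.mul_mem_left _ hy')
    · rw [smul_add, mul_assoc, h, mul_smul y, h', smul_zero, add_zero]

/-- Products from different blocks are comaximal, so a vector of `V(B)` lying in the sum of the
other block spaces is killed both by some `y` and by `1 - y`. Being a block module thus reduces to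
the block spaces spanning. -/
theorem iSupIndep_blockSpace : iSupIndep fun B : Blocks r => blockSpace r V B := by
  intro B
  rw [Submodule.disjoint_def]
  rintro v ⟨I, hI, h⟩ hv
  obtain ⟨y, hy, h'⟩ := exists_annihilator_of_mem_iSup_blockSpace hI hv
  have h₁ := h _ hy
  have h₂ := h' 1
  rw [mul_one] at h₂
  rwa [sub_smul, one_smul, h₂, sub_zero] at h₁

theorem isBlockModule_iff : IsBlockModule r V ↔ ⨆ B, blockSpace r V B = ⊤ := by
  classical
  unfold IsBlockModule
  rw [DirectSum.isInternal_submodule_iff_iSupIndep_and_iSup_eq_top]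
  exact and_iff_right iSupIndep_blockSpace

theorem exists_word_annihilating {B : Blocks r} {v v' : V} (hv : v ∈ blockSpace r V B)
    (hv' : v' ∈ blockSpace r V B) :
    ∃ I : words r B, (∀ x ∈ I.1, x • v = 0) ∧ ∀ x ∈ I.1, x • v' = 0 := by
  obtain ⟨I, hI, h⟩ := hv
  obtain ⟨J, hJ, h'⟩ := hv'
  obtain ⟨K, hK, h₁, h₂⟩ := words_directed hI hJ
  exact ⟨⟨K, hK⟩, fun x hx => h x (h₁ hx), fun x hx => h' x (h₂ hx)⟩

theorem IsBlockModule.induction (hV : IsBlockModule r V) {p : V → Prop}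
    (mem : ∀ B, ∀ v ∈ blockSpace r V B, p v) (zero : p 0) (add : ∀ v v', p v → p v' → p (v + v')) (v : V) :
    p v := by
  have hv : v ∈ ⨆ B, blockSpace r V B := by rw [isBlockModule_iff.1 hV]; trivial
  exact Submodule.iSup_induction _ (motive := p) hv mem zero add

end BlockSpaces

/-! ### Representatives in `A` of elements of `(A/A𝔪)(C)`. -/

section Representatives

variable {k : Type u} [Field k] {A : Type v} [Ring A] [Algebra k A] {Γ : Subalgebra k A}
  {r : Setoid (Cfs k Γ)} {B C D : Blocks r}

theorem LeftRep.neg {I : Ideal Γ} {a : A} (h : LeftRep r I C a) : LeftRep r I C (-a) := by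
  unfold LeftRep; rw [map_neg]; exact neg_mem h

theorem LeftRep.sub {I : Ideal Γ} {a a' : A} (h : LeftRep r I C a) (h' : LeftRep r I C a') :
    LeftRep r I C (a - a') := by
  rw [sub_eq_add_neg]; exact h.add h'.neg

theorem LeftRep.smul {I : Ideal Γ} {a : A} (h : LeftRep r I C a) (c : k) :
    LeftRep r I C (c • a) := by
  obtain ⟨J, hJ, h⟩ := leftRep_iff.1 h
  refine leftRep_iff.2 ⟨J, hJ, fun x hx => ?_⟩
  rw [mul_smul_comm]
  exact Submodule.smul_of_tower_mem _ c (h x hx)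

/-- Modulo `A𝔪`, every element of `A` is a sum of representatives of block space elements. -/
theorem leftRep_induction (h : IsStrongHCBlockSubalgebra Γ r) (I : words r B) {p : A → Prop}
    (mem : ∀ a ∈ leftIdeal Γ I.1, p a) (rep : ∀ C a, LeftRep r I.1 C a → p a)
    (add : ∀ a a', p a → p a' → p (a + a')) (a : A) : p a := by
  suffices ∀ v : A ⧸ leftIdeal Γ I.1, ∃ a, (leftIdeal Γ I.1).mkQ a = v ∧ p a by
    obtain ⟨b, hb, hp⟩ := this ((leftIdeal Γ I.1).mkQ a)
    have : a - b ∈ leftIdeal Γ I.1 := (Submodule.Quotient.eq _).1 hb.symm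
    simpa using add _ _ (mem _ this) hp
  intro v
  have hv : v ∈ ⨆ C, blockSpace r (A ⧸ leftIdeal Γ I.1) C := by
    rw [isBlockModule_iff.1 (h.1 B I.1 I.2).1]; trivial
  refine Submodule.iSup_induction _
    (motive := fun v => ∃ a, (leftIdeal Γ I.1).mkQ a = v ∧ p a) hv ?_ ?_ ?_
  · intro C v hv
    obtain ⟨a, rfl⟩ := (leftIdeal Γ I.1).mkQ_surjective v
    exact ⟨a, rfl, rep C a hv⟩
  · exact ⟨0, map_zero _, mem 0 (zero_mem _)⟩
  · rintro _ _ ⟨a, rfl, ha⟩ ⟨a', rfl, ha'⟩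
    exact ⟨a + a', map_add _ _ _, add _ _ ha ha'⟩

variable (r) in
/-- `𝔫` annihilates the block space `(A/A𝔪)(C)`. -/
def LeftAdapted (I : Ideal Γ) (C : Blocks r) (J : Ideal Γ) : Prop :=
  ∀ a, LeftRep r I C a → ∀ x ∈ J, (x : A) * a ∈ leftIdeal Γ I

theorem LeftAdapted.mono {I J J' : Ideal Γ} (h : LeftAdapted r I C J) (hJ : J' ≤ J) :
    LeftAdapted r I C J' :=
  fun a ha x hx => h a ha x (hJ hx)

theorem exists_leftAdapted_le (h : IsStrongHCBlockSubalgebra Γ r) (I : words r B)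
    (J : words r C) : ∃ J' : words r C, J'.1 ≤ J.1 ∧ LeftAdapted r I.1 C J'.1 := by
  obtain ⟨J', hle, hJ'⟩ := exists_adapted_le h J I I
  exact ⟨J', hle, hJ'.1⟩

/-- The canonical map `(A/A𝔪)(C) → A/(𝔫A + A𝔪)` is injective when `𝔫` annihilates
`(A/A𝔪)(C)`. -/
theorem LeftRep.mem_leftIdeal (h : IsStrongHCBlockSubalgebra Γ r) {I : words r B}
    {J : Ideal Γ} (hJ : LeftAdapted r I.1 C J) {a : A} (ha : LeftRep r I.1 C a)
    (hmem : a ∈ cosetSpace Γ J I.1) : a ∈ leftIdeal Γ I.1 := by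
  obtain ⟨c₁, h₁, c₂, h₂, rfl⟩ := Submodule.mem_sup.1 hmem
  replace h₁ : c₁ ∈ rightIdeal Γ J := h₁
  replace h₂ : c₂ ∈ leftIdeal Γ I.1 := h₂
  have hQ : (leftIdeal Γ I.1).mkQ c₂ = 0 := (Submodule.Quotient.mk_eq_zero _).2 h₂
  refine (leftIdeal Γ I.1).add_mem ?_ h₂
  -- `𝔫` kills the `C`-part of `A/A𝔪` and preserves the other block spaces, so the class of `c₁ ∈
  -- 𝔫A` has no `C`-part. It equals the class of `a`, which lies in the block space at `C`, so it
  -- vanishes by independence.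
  have hc₁ : (leftIdeal Γ I.1).mkQ c₁ ∈
      ⨆ P, ⨆ _ : P ≠ C, blockSpace r (A ⧸ leftIdeal Γ I.1) P := by
    -- Quantifying over a right factor `b` lets the induction pass through right multiplication in
    -- `𝔫A`.
    suffices ∀ b, (leftIdeal Γ I.1).mkQ (c₁ * b) ∈
        ⨆ P, ⨆ _ : P ≠ C, blockSpace r (A ⧸ leftIdeal Γ I.1) P by
      simpa using this 1
    clear ha hmem
    induction h₁ using Submodule.span_induction with
    | mem x hx =>
      obtain ⟨x, hx, rfl⟩ := hx
      intro b
      change (leftIdeal Γ I.1).mkQ ((x : A) * b) ∈ _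
      induction b using leftRep_induction h I with
      | mem b hb =>
        have : (leftIdeal Γ I.1).mkQ ((x : A) * b) = 0 :=
          (Submodule.Quotient.mk_eq_zero _).2 ((leftIdeal Γ I.1).smul_mem (x : A) hb)
        rw [this]; exact zero_mem _
      | rep P b hb =>
        by_cases hP : P = C
        · subst hP
          have : (leftIdeal Γ I.1).mkQ ((x : A) * b) = 0 :=
            (Submodule.Quotient.mk_eq_zero _).2 (hJ b hb x hx)
          rw [this]; exact zero_mem _
        · refine Submodule.mem_iSup_of_mem P (Submodule.mem_iSup_of_mem hP ?_)
          exact (blockSpace r (A ⧸ leftIdeal Γ I.1) P).smul_mem x hb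
      | add b b' hb hb' => rw [mul_add, map_add]; exact add_mem hb hb'
    | zero => intro b; rw [zero_mul, map_zero]; exact zero_mem _
    | add x y _ _ hx hy => intro b; rw [add_mul, map_add]; exact add_mem (hx b) (hy b)
    | smul a x _ hx =>
      intro b
      have : (a • x) * b = x * (a.unop * b) := mul_assoc x a.unop b
      rw [this]; exact hx _
  have hC : (leftIdeal Γ I.1).mkQ c₁ ∈ blockSpace r (A ⧸ leftIdeal Γ I.1) C := by
    unfold LeftRep at ha; rwa [map_add, hQ, add_zero] at ha
  exact (Submodule.Quotient.mk_eq_zero _).1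
    (Submodule.disjoint_def.1 (iSupIndep_blockSpace C) _ hC hc₁)

end Representatives

/-! ### Continuity for the limit topologies in terms of single components. -/

section Topology

variable {k : Type u} [Field k] {A : Type v} [Ring A] [Algebra k A] {Γ : Subalgebra k A}
  {r : Setoid (Cfs k Γ)} {B C : Blocks r}

theorem limHom_eq_zero_of_le {α : limHom r B C} {I I' : words r B} {J J' : words r C}
    (hI : I'.1 ≤ I.1) (hJ : J'.1 ≤ J.1) (h : α.1 I' J' = 0) : α.1 I J = 0 := by
  rw [← α.2 I I' J J' hI hJ, h, map_zero]

/-- The kernels of the projections to the components form a neighbourhood basis at zero, since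
products from a block are directed downwards. A linear map to a discrete space is continuous exactly
when its kernel contains one of them. -/
theorem continuous_limHom_discrete_iff {M : Type w} [AddCommGroup M] [Module k M]
    (f : limHom r B C →ₗ[k] M) :
    @Continuous _ _ (limHomTopology r B C) ⊥ f ↔
      ∃ (I : words r B) (J : words r C), ∀ α : limHom r B C, α.1 I J = 0 → f α = 0 := by
  constructor
  · intro hf
    have h0 : f ⁻¹' {0} ∈ @nhds _ (limHomTopology r B C) 0 :=
      @IsOpen.mem_nhds _ (limHomTopology r B C) (0 : limHom r B C) _
        (@IsOpen.preimage _ _ (limHomTopology r B C) ⊥ f hf {0} trivial) (map_zero f)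
    have e : @nhds _ (limHomTopology r B C) 0 =
        ⨅ p : words r B × words r C, Filter.principal {α : limHom r B C | α.1 p.1 p.2 = 0} := by
      rw [limHomTopology, nhds_iInf, iInf_prod]
      refine iInf_congr fun I => ?_
      rw [nhds_iInf]
      refine iInf_congr fun J => ?_
      let _ : TopologicalSpace (A ⧸ cosetSpace Γ J.1 I.1) := ⊥
      have : DiscreteTopology (A ⧸ cosetSpace Γ J.1 I.1) := ⟨rfl⟩
      rw [nhds_induced, nhds_discrete, ← Filter.principal_singleton, Filter.comap_principal]
      rfl
    have : Nonempty (words r B × words r C) :=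
      ⟨(⟨⊤, top_mem_words B⟩, ⟨⊤, top_mem_words C⟩)⟩
    rw [e, Filter.mem_iInf_of_directed] at h0
    · obtain ⟨⟨I, J⟩, h⟩ := h0
      exact ⟨I, J, fun α hα => h hα⟩
    · rintro ⟨I, J⟩ ⟨I', J'⟩
      obtain ⟨I₁, hI₁, h₁, h₁'⟩ := words_directed I.2 I'.2
      obtain ⟨J₁, hJ₁, h₂, h₂'⟩ := words_directed J.2 J'.2
      refine ⟨(⟨I₁, hI₁⟩, ⟨J₁, hJ₁⟩), ?_, ?_⟩
      · exact Filter.principal_mono.2 fun α hα => limHom_eq_zero_of_le h₁ h₂ hα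
      · exact Filter.principal_mono.2 fun α hα => limHom_eq_zero_of_le h₁' h₂' hα
  · rintro ⟨I, J, h⟩
    refine @Continuous.mk _ _ (limHomTopology r B C) ⊥ f fun S _ => ?_
    refine (iInf₂_le I J : limHomTopology r B C ≤ _) _ ?_
    -- `f` factors through the projection to the component `(I, J)`, so the preimage of `S` is
    -- saturated for it.
    refine ⟨(fun α : limHom r B C => α.1 I J) '' (f ⁻¹' S), trivial, ?_⟩
    refine Set.Subset.antisymm ?_ (Set.subset_preimage_image _ _)
    rintro α ⟨β, hβ, e⟩
    have : f (α - β) = 0 := h _ (by simpa [sub_eq_zero] using e.symm)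
    have hαβ : f α = f β := sub_eq_zero.1 ((f.map_sub α β).symm.trans this)
    rwa [Set.mem_preimage, hαβ]

/-- It suffices to test on lines: finitely many vectors span `U`, and their components have a common
refinement. -/
theorem continuous_limHom_homLimit_iff {M N : Type w} [AddCommGroup M] [Module k M]
    [AddCommGroup N] [Module k N] (f : limHom r B C →ₗ[k] M →ₗ[k] N) :
    @Continuous _ _ (limHomTopology r B C) (homLimitTopology M N) f ↔
      ∀ v : M, ∃ (I : words r B) (J : words r C), ∀ α : limHom r B C, α.1 I J = 0 → f α v = 0 := by
  have e : @Continuous _ _ (limHomTopology r B C) (homLimitTopology M N) f ↔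
      ∀ U : {U : Submodule k M // FiniteDimensional k U},
        ∃ (I : words r B) (J : words r C), ∀ α : limHom r B C, α.1 I J = 0 →
          (f α).domRestrict U.1 = 0 := by
    rw [continuous_iInf_rng]
    refine forall_congr' fun U => ?_
    let g : limHom r B C →ₗ[k] U.1 →ₗ[k] N := (LinearMap.lcomp k N U.1.subtype).comp f
    exact continuous_induced_rng.trans (continuous_limHom_discrete_iff g)
  rw [e]
  constructor
  · intro hf v
    obtain ⟨I, J, h⟩ := hf ⟨Submodule.span k {v}, inferInstance⟩
    exact ⟨I, J, fun α hα => LinearMap.congr_fun (h α hα) ⟨v, Submodule.mem_span_singleton_self v⟩⟩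
  · rintro hf ⟨U, hU⟩
    suffices ∃ (I : words r B) (J : words r C), ∀ α : limHom r B C, α.1 I J = 0 →
        ∀ u ∈ U, f α u = 0 by
      obtain ⟨I, J, h⟩ := this
      exact ⟨I, J, fun α hα => LinearMap.ext fun u => h α hα u u.2⟩
    have hfg : U.FG := Module.Finite.iff_fg.1 hU
    clear hU
    induction U, hfg using Submodule.fg_induction with
    | singleton v =>
      obtain ⟨I, J, h⟩ := hf v
      refine ⟨I, J, fun α hα u hu => ?_⟩
      obtain ⟨c, rfl⟩ := Submodule.mem_span_singleton.1 hu
      rw [map_smul, h α hα, smul_zero]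
    | sup U₁ U₂ _ _ h₁ h₂ =>
      obtain ⟨I, J, h⟩ := h₁
      obtain ⟨I', J', h'⟩ := h₂
      obtain ⟨I₁, hI₁, hI, hI'⟩ := words_directed I.2 I'.2
      obtain ⟨J₁, hJ₁, hJ, hJ'⟩ := words_directed J.2 J'.2
      refine ⟨⟨I₁, hI₁⟩, ⟨J₁, hJ₁⟩, fun α hα u hu => ?_⟩
      obtain ⟨u₁, hu₁, u₂, hu₂, rfl⟩ := Submodule.mem_sup.1 hu
      rw [map_add, h α (limHom_eq_zero_of_le hI hJ hα) u₁ hu₁,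
        h' α (limHom_eq_zero_of_le hI' hJ' hα) u₂ hu₂, add_zero]

end Topology

/-! ### The action of `𝒜(B, C)` on the block spaces of an `A`-module. -/

section Action

variable {k : Type u} [Field k] {A : Type v} [Ring A] [Algebra k A] {Γ : Subalgebra k A}
  {r : Setoid (Cfs k Γ)} {B C D : Blocks r}
  {V : Type w} [AddCommGroup V] [Module A V]

theorem smul_eq_zero_of_mem_leftIdeal {I : Ideal Γ} {v : V} (hv : ∀ x ∈ I, x • v = 0) {a : A}
    (ha : a ∈ leftIdeal Γ I) : a • v = 0 := by
  induction ha using Submodule.span_induction with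
  | mem x hx =>
    obtain ⟨x, hx, rfl⟩ := hx
    exact hv x hx
  | zero => exact zero_smul _ _
  | add x y _ _ hx hy => rw [add_smul, hx, hy, add_zero]
  | smul a x _ hx => rw [smul_assoc, hx, smul_zero]

theorem LeftRep.smul_mem_blockSpace {I : Ideal Γ} {a : A} (ha : LeftRep r I C a) {v : V}
    (hv : ∀ x ∈ I, x • v = 0) : a • v ∈ blockSpace r V C := by
  obtain ⟨J, hJ, h⟩ := leftRep_iff.1 ha
  refine ⟨J, hJ, fun x hx => ?_⟩
  have := smul_eq_zero_of_mem_leftIdeal hv (h x hx)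
  rwa [mul_smul] at this

/-- `w` is the value at `v` of the action of `α`, as computed from auxiliary products `𝔪`
annihilating `v` and `𝔫` annihilating `(A/A𝔪)(C)`. -/
def IsActAt (α : limHom r B C) (v w : V) : Prop :=
  ∃ (I : words r B) (J : words r C) (a : A), (∀ x ∈ I.1, x • v = 0) ∧ LeftAdapted r I.1 C J.1 ∧
    α.1 I J = (cosetSpace Γ J.1 I.1).mkQ a ∧ LeftRep r I.1 C a ∧ w = a • v

theorem exists_isActAt (h : IsStrongHCBlockSubalgebra Γ r) (α : limHom r B C) {v : V}
    (hv : v ∈ blockSpace r V B) : ∃ w, IsActAt α v w := by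
  obtain ⟨I, hI, hIv⟩ := hv
  obtain ⟨J, -, hJ⟩ := exists_leftAdapted_le h ⟨I, hI⟩ ⟨⊤, top_mem_words C⟩
  obtain ⟨a, ha, ha'⟩ := exists_leftRep_eq h α ⟨I, hI⟩ J
  exact ⟨_, ⟨I, hI⟩, J, a, hIv, hJ, ha, ha', rfl⟩

theorem IsActAt.unique (h : IsStrongHCBlockSubalgebra Γ r) {α : limHom r B C} {v w w' : V}
    (hw : IsActAt α v w) (hw' : IsActAt α v w') : w = w' := by
  obtain ⟨I, J, a, hI, hJ, ha, hr, rfl⟩ := hw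
  obtain ⟨I', J', a', hI', hJ', ha', hr', rfl⟩ := hw'
  obtain ⟨K, hK, hKI, hKI'⟩ := words_directed I.2 I'.2
  obtain ⟨L, hL, hLJ, hLJ'⟩ := words_directed J.2 J'.2
  obtain ⟨b, hb, hbr⟩ := exists_leftRep_eq h α ⟨K, hK⟩ ⟨L, hL⟩
  have key : ∀ {I : words r B} {J : words r C} {a : A}, (∀ x ∈ I.1, x • v = 0) →
      LeftAdapted r I.1 C J.1 → α.1 I J = (cosetSpace Γ J.1 I.1).mkQ a → LeftRep r I.1 C a →
      K ≤ I.1 → L ≤ J.1 → a • v = b • v := by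
    intro I J a hI hJ ha hr hKI hLJ
    -- Both representatives lift the same class of `A/(𝔫A + A𝔪)`, so by injectivity they differ by
    -- an element of `A𝔪`, which kills `v`.
    have e := smul_eq_zero_of_mem_leftIdeal hI
      ((hr.sub (hbr.mono hKI)).mem_leftIdeal h hJ
        (mkQ_eq_iff.1 (ha.symm.trans (limHom_factor α hKI hLJ hb))))
    rwa [sub_smul, sub_eq_zero] at e
  rw [key hI hJ ha hr hKI hLJ, key hI' hJ' ha' hr' hKI' hLJ']

theorem IsActAt.mem_blockSpace {α : limHom r B C} {v w : V} (hw : IsActAt α v w) :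
    w ∈ blockSpace r V C := by
  obtain ⟨I, J, a, hI, hJ, ha, hr, rfl⟩ := hw
  exact hr.smul_mem_blockSpace hI

/-- An action value can be computed from arbitrarily small auxiliary products. -/
theorem IsActAt.exists_le (h : IsStrongHCBlockSubalgebra Γ r) {α : limHom r B C} {v w : V}
    (hw : IsActAt α v w) {I₀ : words r B} (J₀ : words r C) (hI₀ : ∀ x ∈ I₀.1, x • v = 0) :
    ∃ (J : words r C) (a : A), J.1 ≤ J₀.1 ∧ LeftAdapted r I₀.1 C J.1 ∧
      α.1 I₀ J = (cosetSpace Γ J.1 I₀.1).mkQ a ∧ LeftRep r I₀.1 C a ∧ w = a • v := by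
  obtain ⟨J, hle, hJ⟩ := exists_leftAdapted_le h I₀ J₀
  obtain ⟨a, ha, ha'⟩ := exists_leftRep_eq h α I₀ J
  exact ⟨J, a, hle, hJ, ha, ha', hw.unique h ⟨I₀, J, a, hI₀, hJ, ha, ha', rfl⟩⟩

theorem IsActAt.add (h : IsStrongHCBlockSubalgebra Γ r) {α : limHom r B C} {v v' w w' : V}
    (hv : v ∈ blockSpace r V B) (hv' : v' ∈ blockSpace r V B)
    (hw : IsActAt α v w) (hw' : IsActAt α v' w') : IsActAt α (v + v') (w + w') := by
  obtain ⟨I, hI, hI'⟩ := exists_word_annihilating hv hv'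
  obtain ⟨J, a, -, hJ, ha, hr, rfl⟩ := hw.exists_le h ⟨⊤, top_mem_words C⟩ hI
  rw [hw'.unique h ⟨I, J, a, hI', hJ, ha, hr, rfl⟩, ← smul_add]
  exact ⟨I, J, a, fun x hx => by rw [smul_add, hI x hx, hI' x hx, add_zero], hJ, ha, hr, rfl⟩

theorem IsActAt.add_left (h : IsStrongHCBlockSubalgebra Γ r) {α β : limHom r B C} {v w w' : V}
    (hw : IsActAt α v w) (hw' : IsActAt β v w') : IsActAt (α + β) v (w + w') := by
  obtain ⟨I, J, a, hI, hJ, ha, hr, rfl⟩ := hw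
  obtain ⟨J', b, hle, hJ', hb, hr', rfl⟩ := hw'.exists_le h J hI
  refine ⟨I, J, a + b, hI, hJ, ?_, hr.add hr', (add_smul a b v).symm⟩
  rw [map_add, ← ha, ← limHom_factor β le_rfl hle hb]
  rfl

theorem IsActAt.smul_left [Module k V] [IsScalarTower k A V] {α : limHom r B C} {v w : V}
    (hw : IsActAt α v w) (c : k) : IsActAt (c • α) v (c • w) := by
  obtain ⟨I, J, a, hI, hJ, ha, hr, rfl⟩ := hw
  refine ⟨I, J, c • a, hI, hJ, ?_, hr.smul c, (smul_assoc c a v).symm⟩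
  rw [map_smul, ← ha]
  rfl

/-- If `𝔫` annihilates `(A/A𝔪)(C)`, it kills `a v`, so left representatives `a` of `α` and `b'` of
`β` can be multiplied. The definition of `β ∘ α` uses a right representative `b` instead; `b - b' ∈
𝔩A + A𝔫`, and right multiplication by `a` sends this into `𝔩A + A𝔪`. -/
theorem IsActAt.comp (h : IsStrongHCBlockSubalgebra Γ r) {α : limHom r B C} {β : limHom r C D}
    {v w z : V} (hw : IsActAt α v w) (hz : IsActAt β w z) : IsActAt (limComp h α β) v z := by
  obtain ⟨I, J₀, a₀, hI, -⟩ := id hw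
  -- `L` comes first because `J` must be adapted to it; the product `L'` needed to evaluate `β`
  -- depends on `J` and is taken below `L` afterwards.
  obtain ⟨L, -, hL⟩ := exists_leftAdapted_le h I ⟨⊤, top_mem_words D⟩
  obtain ⟨J₁, -, hJ₁⟩ := exists_adapted_le h (⟨⊤, top_mem_words C⟩ : words r C) I L
  obtain ⟨J, a, hle, hJ, ha, hr, rfl⟩ := hw.exists_le h J₁ hI
  have hJv : ∀ x ∈ J.1, x • a • v = 0 := fun x hx => by
    have := smul_eq_zero_of_mem_leftIdeal hI (hJ a hr x hx)
    rwa [mul_smul] at this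
  obtain ⟨L', b', hle', -, hb', hr', rfl⟩ := hz.exists_le h L hJv
  obtain ⟨b, hb, hbr⟩ := exists_rightRep_eq h β J L
  refine ⟨I, L, b' * a, hI, hL, ?_, ?_, (mul_smul b' a v).symm⟩
  · rw [limComp_eq h (hJ₁.mono hle) ha hr hb hbr]
    refine mkQ_eq_iff.2 ?_
    rw [← sub_mul]
    exact mul_mem_cosetSpace_right (hJ a hr)
      (mkQ_eq_iff.1 (hb.symm.trans (limHom_factor β le_rfl hle' hb')))
  -- The module here is `A/A𝔪` itself, with the vector `a + A𝔪`, which `𝔫` kills.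
  · exact hr'.smul_mem_blockSpace (v := (leftIdeal Γ I.1).mkQ a) fun x hx =>
      (Submodule.Quotient.mk_eq_zero _).2 (hJ a hr x hx)

theorem isActAt_one (h : IsStrongHCBlockSubalgebra Γ r) {v : V} (hv : v ∈ blockSpace r V B) :
    IsActAt (ofElement r B B 1) v v := by
  obtain ⟨I, hI, hIv⟩ := hv
  obtain ⟨J, -, hJ⟩ := exists_leftAdapted_le h ⟨I, hI⟩ ⟨⊤, top_mem_words B⟩
  refine ⟨⟨I, hI⟩, J, 1, hIv, hJ, rfl, leftRep_iff.2 ⟨I, hI, fun x hx => ?_⟩, (one_smul A v).symm⟩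
  simpa using mul_mem_leftIdeal 1 hx

theorem LeftRep.isActAt (h : IsStrongHCBlockSubalgebra Γ r) {I : words r B} {a : A}
    (ha : LeftRep r I.1 C a) {v : V} (hv : ∀ x ∈ I.1, x • v = 0) :
    IsActAt (ofElement r B C a) v (a • v) := by
  obtain ⟨J, -, hJ⟩ := exists_leftAdapted_le h I ⟨⊤, top_mem_words C⟩
  exact ⟨I, J, a, hv, hJ, rfl, ha, rfl⟩

theorem IsActAt.map {W : Type*} [AddCommGroup W] [Module A W] (f : V →ₗ[A] W) {α : limHom r B C}
    {v w : V} (hw : IsActAt α v w) : IsActAt α (f v) (f w) := by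
  obtain ⟨I, J, a, hI, hJ, ha, hr, rfl⟩ := hw
  refine ⟨I, J, a, fun x hx => ?_, hJ, ha, hr, map_smul f a v⟩
  have e : f ((x : A) • v) = (x : A) • f v := map_smul f _ _
  exact e.symm.trans ((congrArg f (hI x hx)).trans (map_zero f))

variable [Module k V] [IsScalarTower k A V]

/-- The action of `𝒜(B, C)` on the block spaces of an `A`-module. -/
noncomputable def blockAct (h : IsStrongHCBlockSubalgebra Γ r) (α : limHom r B C) :
    blockSpace r V B →ₗ[k] blockSpace r V C where
  toFun v := ⟨(exists_isActAt h α v.2).choose,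
    (exists_isActAt h α v.2).choose_spec.mem_blockSpace⟩
  map_add' v v' := Subtype.ext <| (exists_isActAt h α (v + v').2).choose_spec.unique h <|
    (exists_isActAt h α v.2).choose_spec.add h v.2 v'.2 (exists_isActAt h α v'.2).choose_spec
  map_smul' c v := by
    refine Subtype.ext <| (exists_isActAt h α (c • v).2).choose_spec.unique h ?_
    have := (exists_isActAt h α v.2).choose_spec
    obtain ⟨I, J, a, hI, hJ, ha, hr, e⟩ := this
    refine ⟨I, J, a, fun x hx => ?_, hJ, ha, hr, ?_⟩
    · have e : (x : A) • c • v.1 = c • (x : A) • v.1 := smul_comm (x : A) c v.1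
      exact e.trans ((congrArg (c • ·) (hI x hx)).trans (smul_zero c))
    · exact (congrArg (c • ·) e).trans (smul_comm a c v.1).symm

theorem blockAct_isActAt (h : IsStrongHCBlockSubalgebra Γ r) (α : limHom r B C)
    (v : blockSpace r V B) : IsActAt α v.1 (blockAct h α v).1 :=
  (exists_isActAt h α v.2).choose_spec

theorem IsActAt.blockAct_eq (h : IsStrongHCBlockSubalgebra Γ r) {α : limHom r B C}
    {v : blockSpace r V B} {w : V} (hw : IsActAt α v.1 w) : (blockAct h α v).1 = w :=
  (blockAct_isActAt h α v).unique h hw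

end Action

/-! ### The functor of block spaces: full and faithful on block modules. -/

section Functor

variable {k : Type u} [Field k] {A : Type v} [Ring A] [Algebra k A] {Γ : Subalgebra k A}
  {r : Setoid (Cfs k Γ)}

open scoped ModuleCat.Algebra

/-- The functor `B ↦ V(B)` attached to an `A`-module `V`. -/
noncomputable def blockFunctor (h : IsStrongHCBlockSubalgebra Γ r) (V : ModuleCat.{w} A) :
    BlockCat Γ r h ⥤ ModuleCat.{w} k where
  obj B := ModuleCat.of k (blockSpace r V (show Blocks r from B))
  map {B C} α := ModuleCat.ofHom (blockAct (V := V) h (show limHom r B C from α))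
  map_id _ := ModuleCat.hom_ext <| LinearMap.ext fun v => Subtype.ext <|
    (isActAt_one h v.2).blockAct_eq h
  map_comp {_ C D} α β := ModuleCat.hom_ext <| LinearMap.ext fun v => Subtype.ext <|
    IsActAt.blockAct_eq h <| (blockAct_isActAt h α v).comp h
      (blockAct_isActAt h (show limHom r C D from β) _)

/-- The restriction `V(B) → W(B)` of a morphism of `A`-modules. -/
def blockMap (V W : ModuleCat.{w} A) (f : V ⟶ W) (B : Blocks r) :
    blockSpace r V B →ₗ[k] blockSpace r W B where
  toFun v := ⟨f.hom v.1, by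
    obtain ⟨I, hI, hv⟩ := v.2
    refine ⟨I, hI, fun x hx => ?_⟩
    have e : f.hom ((x : A) • v.1) = (x : A) • f.hom v.1 := map_smul f.hom _ _
    exact e.symm.trans ((congrArg f.hom (hv x hx)).trans (map_zero f.hom))⟩
  map_add' v v' := Subtype.ext (map_add f.hom v.1 v'.1)
  map_smul' c v := Subtype.ext (map_smul f.hom (algebraMap k A c) v.1)

/-- The functor sending an `A`-module `V` to `B ↦ V(B)`. -/
noncomputable def blockSpacesFunctor (h : IsStrongHCBlockSubalgebra Γ r) :
    ModuleCat.{w} A ⥤ BlockCat Γ r h ⥤ ModuleCat.{w} k where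
  obj V := blockFunctor h V
  map {V W} f :=
    { app B := ModuleCat.ofHom (blockMap V W f (show Blocks r from B))
      naturality B C α := ModuleCat.hom_ext <| LinearMap.ext fun v => Subtype.ext <|
        (((blockAct_isActAt h (show limHom r B C from α) v).map f.hom).blockAct_eq h
          (v := blockMap V W f (show Blocks r from B) v)).symm }
  map_id _ := rfl
  map_comp _ _ := rfl

theorem blockSpacesFunctor_map_injective (h : IsStrongHCBlockSubalgebra Γ r)
    {V W : ModuleCat.{w} A} (hV : IsBlockModule r V) {f g : V ⟶ W}
    (hfg : (blockSpacesFunctor h).map f = (blockSpacesFunctor h).map g) : f = g := by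
  refine ModuleCat.hom_ext <| LinearMap.ext fun v => ?_
  refine hV.induction (p := fun v => f.hom v = g.hom v) ?_ ?_ ?_ v
  · intro B v hv
    have e : blockMap (k := k) V W f B = blockMap V W g B :=
      congrArg (fun η : (blockSpacesFunctor h).obj V ⟶ (blockSpacesFunctor h).obj W =>
        ModuleCat.Hom.hom (R := k) (A := ModuleCat.of k (blockSpace r V B))
          (B := ModuleCat.of k (blockSpace r W B)) (NatTrans.app η (B : BlockCat Γ r h))) hfg
    exact congrArg Subtype.val (LinearMap.congr_fun e ⟨v, hv⟩)
  · rw [map_zero, map_zero]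
  · intro v v' e e'
    rw [map_add, map_add, e, e']

theorem exists_addMonoidHom_of_isBlockModule {V W : Type w} [AddCommGroup V] [Module Γ V]
    [AddCommGroup W] (hV : IsBlockModule r V) (e : ∀ B, blockSpace r V B →+ W) :
    ∃ f : V →+ W, ∀ B (v : blockSpace r V B), f v = e B v := by
  classical
  let E := AddEquiv.ofBijective _ hV
  refine ⟨(DirectSum.toAddMonoid e).comp E.symm.toAddMonoidHom, fun B v => ?_⟩
  have : E.symm v.1 = DirectSum.of (fun B => blockSpace r V B) B v := by
    rw [AddEquiv.symm_apply_eq]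
    exact (DirectSum.coeAddMonoidHom_of _ B v).symm
  change DirectSum.toAddMonoid e (E.symm v.1) = _
  rw [this, DirectSum.toAddMonoid_of]

theorem blockSpacesFunctor_map_surjective (h : IsStrongHCBlockSubalgebra Γ r)
    {V W : ModuleCat.{w} A} (hV : IsBlockModule r V)
    (η : (blockSpacesFunctor h).obj V ⟶ (blockSpacesFunctor h).obj W) :
    ∃ f : V ⟶ W, (blockSpacesFunctor h).map f = η := by
  let e (B : Blocks r) : blockSpace r V B →ₗ[k] blockSpace r W B :=
    ModuleCat.Hom.hom (R := k) (A := ModuleCat.of k (blockSpace r V B))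
      (B := ModuleCat.of k (blockSpace r W B)) (NatTrans.app η (B : BlockCat Γ r h))
  have he {B C : Blocks r} (α : limHom r B C) (v : blockSpace r V B) :
      e C (blockAct h α v) = blockAct h α (e B v) :=
    LinearMap.congr_fun (congrArg ModuleCat.Hom.hom
      (η.naturality (X := (show BlockCat Γ r h from B)) (Y := (show BlockCat Γ r h from C)) α)) v
  obtain ⟨f, hf⟩ := exists_addMonoidHom_of_isBlockModule hV fun B =>
    (blockSpace r W B).subtype.toAddMonoidHom.comp (e B).toAddMonoidHom
  replace hf {B : Blocks r} (v : blockSpace r V B) : f v = (e B v).1 := hf B v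
  have hsmul (a : A) (v : V) : f (a • v) = a • f v := by
    refine hV.induction (p := fun v => f (a • v) = a • f v) ?_ ?_ ?_ v
    · intro B v hv
      obtain ⟨I₁, hI₁, h₁⟩ := id hv
      obtain ⟨I₂, hI₂, h₂⟩ := (e B ⟨v, hv⟩).2
      -- One product kills both `v` and its image, so the same representatives of `a` modulo `A𝔪`
      -- compute both actions.
      obtain ⟨I, hI, hle₁, hle₂⟩ := words_directed hI₁ hI₂
      replace h₁ : ∀ x ∈ I, x • v = 0 := fun x hx => h₁ x (hle₁ hx)
      replace h₂ : ∀ x ∈ I, x • (e B ⟨v, hv⟩).1 = 0 := fun x hx => h₂ x (hle₂ hx)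
      rw [hf ⟨v, hv⟩]
      induction a using leftRep_induction h ⟨I, hI⟩ with
      | mem a ha =>
        rw [smul_eq_zero_of_mem_leftIdeal h₁ ha, smul_eq_zero_of_mem_leftIdeal h₂ ha, map_zero]
      | rep C a ha =>
        have e₁ := (ha.isActAt h h₁).blockAct_eq h (v := ⟨v, hv⟩)
        have e₂ := (ha.isActAt h h₂).blockAct_eq h
        rw [← e₁, hf, he, e₂]
      | add a a' ha ha' => rw [add_smul, add_smul, map_add, ha, ha']
    · rw [smul_zero, map_zero, smul_zero]
    · intro v v' e e'
      rw [smul_add, map_add, map_add, smul_add, e, e']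
  refine ⟨ModuleCat.ofHom { toFun := f, map_add' := map_add f, map_smul' := hsmul }, ?_⟩
  refine NatTrans.ext (funext fun B => ModuleCat.hom_ext <| LinearMap.ext fun v =>
    Subtype.ext (hf v))

/-! ### Profinite and discrete modules, and strong block modules. -/

theorem isProfinite_iff (h : IsStrongHCBlockSubalgebra Γ r)
    (F : BlockCat Γ r h ⥤ ModuleCat.{w} k) :
    IsProfinite h F ↔ ∀ B C : Blocks r, IsLinearMap k (functorMap F B C) ∧
      ∀ v, ∃ (I : words r B) (J : words r C), ∀ α : limHom r B C, α.1 I J = 0 →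
        functorMap F B C α v = 0 :=
  forall₂_congr fun B C => and_congr_right fun hl =>
    continuous_limHom_homLimit_iff (IsLinearMap.mk' (functorMap F B C) hl)

theorem isDiscrete_iff (h : IsStrongHCBlockSubalgebra Γ r)
    (F : BlockCat Γ r h ⥤ ModuleCat.{w} k) :
    IsDiscrete h F ↔ ∀ B C : Blocks r, IsLinearMap k (functorMap F B C) ∧
      ∃ (I : words r B) (J : words r C), ∀ α : limHom r B C, α.1 I J = 0 →
        functorMap F B C α = 0 :=
  forall₂_congr fun B C => and_congr_right fun hl =>
    continuous_limHom_discrete_iff (IsLinearMap.mk' (functorMap F B C) hl)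

theorem IsDiscrete.isProfinite {h : IsStrongHCBlockSubalgebra Γ r}
    {F : BlockCat Γ r h ⥤ ModuleCat.{w} k} (hF : IsDiscrete h F) : IsProfinite h F := by
  rw [isProfinite_iff]
  intro B C
  obtain ⟨hl, I, J, hIJ⟩ := (isDiscrete_iff h F).1 hF B C
  exact ⟨hl, fun v => ⟨I, J, fun α hα => by rw [hIJ α hα]; rfl⟩⟩

theorem isLinearMap_functorMap_blockFunctor (h : IsStrongHCBlockSubalgebra Γ r)
    (V : ModuleCat.{w} A) (B C : BlockCat Γ r h) :
    IsLinearMap k (functorMap (blockFunctor h V) B C) where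
  map_add α β := LinearMap.ext fun v => Subtype.ext <|
    ((blockAct_isActAt h α v).add_left h (blockAct_isActAt h β v)).blockAct_eq h
  map_smul c α := LinearMap.ext fun v => Subtype.ext <|
    ((blockAct_isActAt h α v).smul_left c).blockAct_eq h

theorem isActAt_zero_of_apply_eq_zero {B C : Blocks r} {V : Type w} [AddCommGroup V] [Module A V]
    {I : words r B} {J : words r C} {v : V} (hI : ∀ x ∈ I.1, x • v = 0)
    (hJ : LeftAdapted r I.1 C J.1) {α : limHom r B C} (hα : α.1 I J = 0) : IsActAt α v 0 :=
  ⟨I, J, 0, hI, hJ, by rw [hα, map_zero], leftRep_zero, (zero_smul A v).symm⟩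

theorem isProfinite_blockFunctor (h : IsStrongHCBlockSubalgebra Γ r) (V : ModuleCat.{w} A) :
    IsProfinite h (blockFunctor h V) := by
  rw [isProfinite_iff]
  refine fun B C => ⟨isLinearMap_functorMap_blockFunctor h V B C, ?_⟩
  rintro ⟨v, I, hI, hv⟩
  obtain ⟨J, -, hJ⟩ := exists_leftAdapted_le h ⟨I, hI⟩ ⟨⊤, top_mem_words C⟩
  exact ⟨⟨I, hI⟩, J, fun α hα => Subtype.ext <|
    (isActAt_zero_of_apply_eq_zero hv hJ hα).blockAct_eq h (v := ⟨v, I, hI, hv⟩)⟩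

/-- A single `𝔪` killing `V(B)` allows one pair `(𝔪, 𝔫)` for all vectors at once; `𝔫` depends only
on `𝔪`. -/
theorem isDiscrete_blockFunctor (h : IsStrongHCBlockSubalgebra Γ r) {V : ModuleCat.{w} A}
    (hV : IsStrongBlockModule r V) : IsDiscrete h (blockFunctor h V) := by
  rw [isDiscrete_iff]
  refine fun B C => ⟨isLinearMap_functorMap_blockFunctor h V B C, ?_⟩
  obtain ⟨I, hI, hv⟩ := hV.2 B
  obtain ⟨J, -, hJ⟩ := exists_leftAdapted_le h ⟨I, hI⟩ ⟨⊤, top_mem_words C⟩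
  exact ⟨⟨I, hI⟩, J, fun α hα => LinearMap.ext fun v => Subtype.ext <|
    (isActAt_zero_of_apply_eq_zero (fun x hx => hv x hx v.1 v.2) hJ hα).blockAct_eq h (v := v)⟩

theorem mem_isActAt_ofElement (h : IsStrongHCBlockSubalgebra Γ r) {B : Blocks r} {V : Type w}
    [AddCommGroup V] [Module A V] (x : Γ) {v : V} (hv : v ∈ blockSpace r V B) :
    IsActAt (ofElement r B B x) v (x • v) := by
  obtain ⟨I, hI, hIv⟩ := hv
  refine LeftRep.isActAt h (I := ⟨I, hI⟩) (leftRep_iff.2 ⟨I, hI, fun y hy => ?_⟩) hIv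
  simpa using mul_mem_leftIdeal 1 (words_mul_mem hI hy x)

/-- `Γ` acts on `V(B)` through its image in `𝒜(B, B)`. Elements of `𝔪` have zero `(𝔪, 𝔫)` component
there, so the `𝔪` provided by discreteness annihilates `V(B)`. -/
theorem isStrongBlockModule_of_isDiscrete (h : IsStrongHCBlockSubalgebra Γ r)
    {V : ModuleCat.{w} A} (hV : IsBlockModule r V) (hF : IsDiscrete h (blockFunctor h V)) :
    IsStrongBlockModule r V := by
  refine ⟨hV, fun B => ?_⟩
  obtain ⟨-, I, J, hIJ⟩ := (isDiscrete_iff h _).1 hF B B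
  refine ⟨I.1, I.2, fun x hx v hv => ?_⟩
  have e : blockAct (V := V) h (ofElement r B B (x : A)) = 0 := hIJ _ <|
    (Submodule.Quotient.mk_eq_zero _).2 <| left_mem_cosetSpace <| by
      simpa using mul_mem_leftIdeal 1 hx
  rw [← (mem_isActAt_ofElement h x hv).blockAct_eq h (v := ⟨v, hv⟩), e]
  rfl

end Functor
-- Images of elements of `A` in `𝒜` and their compositions.
section Elements

variable {k : Type u} [Field k] {A : Type v} [Ring A] [Algebra k A] {Γ : Subalgebra k A}
  {r : Setoid (Cfs k Γ)} {B C D : Blocks r}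

theorem leftRep_coe (I : words r B) (x : Γ) : LeftRep r I.1 B (x : A) :=
  leftRep_iff.2 ⟨I.1, I.2, fun y hy => by
    simpa using mul_mem_leftIdeal 1 (words_mul_mem I.2 hy x)⟩

theorem rightRep_coe (L : words r C) (x : Γ) : RightRep r L.1 C (x : A) :=
  rightRep_iff.2 ⟨L.1, L.2, fun y hy => by
    simpa using mul_mem_rightIdeal (L.1.mul_mem_left x hy) (1 : A)⟩

/-- The composition of the images of `a` and `b` is the image of `b a` in every component `𝔪` with
`a + A𝔪 ∈ (A/A𝔪)(C)`. -/
theorem limComp_ofElement_apply (h : IsStrongHCBlockSubalgebra Γ r) {I : words r B} {a : A}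
    (ha : LeftRep r I.1 C a) (b : A) (L : words r D) :
    (limComp h (ofElement r B C a) (ofElement r C D b)).1 I L =
      (cosetSpace Γ L.1 I.1).mkQ (b * a) := by
  obtain ⟨J, -, hJ⟩ := exists_adapted_le h (⟨⊤, top_mem_words C⟩ : words r C) I L
  obtain ⟨b₀, hb, hb'⟩ := exists_rightRep_eq h (ofElement r C D b) J L
  rw [limComp_eq h hJ rfl ha hb hb']
  -- `b₀ - b ∈ 𝔩A + A𝔫`, and `𝔫 a ⊆ A𝔪` turns right multiplication by `a` into a map to `𝔩A + A𝔪`.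
  refine mkQ_eq_iff.2 ?_
  rw [← sub_mul]
  exact mul_mem_cosetSpace_right (hJ.1 a ha) (mkQ_eq_iff.1 hb.symm)

theorem limComp_ofElement_coe_left (h : IsStrongHCBlockSubalgebra Γ r) (x : Γ) (a : A) :
    limComp h (ofElement r B B (x : A)) (ofElement r B C a) = ofElement r B C (a * x) :=
  Subtype.ext <| funext fun I => funext fun L =>
    limComp_ofElement_apply h (leftRep_coe I x) a L

theorem limComp_ofElement_coe_right (h : IsStrongHCBlockSubalgebra Γ r) (x : Γ) (a : A) :
    limComp h (ofElement r B C a) (ofElement r C C (x : A)) = ofElement r B C (x * a) := by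
  refine Subtype.ext <| funext fun I => funext fun L => ?_
  obtain ⟨J, -, hJ⟩ := exists_adapted_le h (⟨⊤, top_mem_words C⟩ : words r C) I L
  obtain ⟨a₀, ha, ha'⟩ := exists_leftRep_eq h (ofElement r B C a) I J
  rw [limComp_eq h hJ ha ha' rfl (rightRep_coe L x)]
  refine mkQ_eq_iff.2 ?_
  rw [← mul_sub]
  exact mul_mem_cosetSpace_left (hJ.2 _ (rightRep_coe L x)) (mkQ_eq_iff.1 ha.symm)

/-- Comaximality writes `1 = y + z` with `y ∈ 𝔫`, `z ∈ 𝔪`, whence `x = y x + z x ∈ 𝔫A + A𝔪`.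
Elements of `Γ` thus act by block-diagonal matrices. -/
theorem ofElement_coe_eq_zero (hBC : C ≠ B) (x : Γ) : ofElement r B C (x : A) = 0 := by
  refine Subtype.ext <| funext fun I => funext fun L => ?_
  refine (Submodule.Quotient.mk_eq_zero _).2 ?_
  obtain ⟨y, hy, z, hz, e⟩ := words_comaximal hBC L.2 I.2
  have e' : (x : A) = (y : A) * x + 1 * ((z * x : Γ) : A) := by
    rw [one_mul, Subalgebra.coe_mul, ← add_mul, ← Subalgebra.coe_add, e, Subalgebra.coe_one,
      one_mul]
  rw [e']
  exact add_mem (right_mem_cosetSpace (mul_mem_rightIdeal hy _))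
    (left_mem_cosetSpace (mul_mem_leftIdeal 1 (words_mul_mem I.2 hz x)))

end Elements

/-! ### The `A`-module structure on the sum of the fibres of a profinite module. -/

section Entries

variable {k : Type u} [Field k] {A : Type v} [Ring A] [Algebra k A] {Γ : Subalgebra k A}
  {r : Setoid (Cfs k Γ)} {h : IsStrongHCBlockSubalgebra Γ r}
  (F : BlockCat Γ r h ⥤ ModuleCat.{w} k)

/-- The value of a functor on `𝒜` at a block. -/
def fiber (B : Blocks r) : ModuleCat.{w} k := F.obj B

/-- The action of `𝒜(B, C)` on a functor on `𝒜`. -/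
def fiberMap {B C : Blocks r} (α : limHom r B C) : fiber F B →ₗ[k] fiber F C :=
  functorMap F B C α

variable {B C D : Blocks r}

theorem fiberMap_limComp (α : limHom r B C) (β : limHom r C D) (v : fiber F B) :
    fiberMap F (limComp h α β) v = fiberMap F β (fiberMap F α v) :=
  LinearMap.congr_fun (congrArg ModuleCat.Hom.hom
    (F.map_comp (X := (B : BlockCat Γ r h)) (Y := (C : BlockCat Γ r h))
      (Z := (D : BlockCat Γ r h)) α β)) v

variable (B C) in
/-- The operator `F(B) → F(C)` given by the image of `a ∈ A` in `𝒜(B, C)`. -/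
def entry (a : A) : fiber F B →ₗ[k] fiber F C :=
  fiberMap F (ofElement r B C a)

theorem entry_one (v : fiber F B) : entry F B B 1 v = v :=
  LinearMap.congr_fun (congrArg ModuleCat.Hom.hom (F.map_id (B : BlockCat Γ r h))) v

theorem entry_mul_coe (a : A) (x : Γ) (v : fiber F B) :
    entry F B C (a * x) v = entry F B C a (entry F B B x v) := by
  rw [entry, ← limComp_ofElement_coe_left h, fiberMap_limComp]; rfl

theorem entry_coe_mul (a : A) (x : Γ) (v : fiber F B) :
    entry F B C (x * a) v = entry F C C x (entry F B C a v) := by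
  rw [entry, ← limComp_ofElement_coe_right h, fiberMap_limComp]; rfl

variable {F} (hF : IsProfinite h F)
include hF

theorem fiberMap_add (α β : limHom r B C) : fiberMap F (α + β) = fiberMap F α + fiberMap F β :=
  (hF B C).1.map_add α β

theorem fiberMap_smul (c : k) (α : limHom r B C) : fiberMap F (c • α) = c • fiberMap F α :=
  (hF B C).1.map_smul c α

theorem fiberMap_zero : fiberMap F (0 : limHom r B C) = 0 := by
  simpa using fiberMap_smul hF 0 (0 : limHom r B C)

theorem fiberMap_sub (α β : limHom r B C) : fiberMap F (α - β) = fiberMap F α - fiberMap F β := by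
  rw [eq_sub_iff_add_eq, ← fiberMap_add hF]
  exact congrArg (fiberMap F) (sub_add_cancel α β)

theorem exists_fiberMap_eq_zero (C : Blocks r) (v : fiber F B) :
    ∃ (I : words r B) (J : words r C), ∀ α : limHom r B C, α.1 I J = 0 → fiberMap F α v = 0 :=
  ((isProfinite_iff h F).1 hF B C).2 v

theorem entry_add (a b : A) : entry F B C (a + b) = entry F B C a + entry F B C b :=
  fiberMap_add hF (ofElement r B C a) (ofElement r B C b)

theorem entry_zero : entry F B C 0 = 0 := by
  simpa using entry_add (B := B) (C := C) hF 0 0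

theorem entry_smul (c : k) (a : A) : entry F B C (c • a) = c • entry F B C a :=
  fiberMap_smul hF c (ofElement r B C a)

theorem entry_coe_of_ne (hBC : C ≠ B) (x : Γ) : entry F B C x = 0 := by
  rw [entry, ofElement_coe_eq_zero hBC, fiberMap_zero hF]

/-- Continuity yields a component `(𝔪, 𝔫)` controlling the action on `v`, and it vanishes on the
image of `𝔪`. This makes `F(B)` a single block over `Γ`. -/
theorem exists_entry_eq_zero (v : fiber F B) :
    ∃ I : words r B, ∀ x ∈ I.1, entry F B B x v = 0 := by
  obtain ⟨I, J, hIJ⟩ := exists_fiberMap_eq_zero hF B v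
  refine ⟨I, fun x hx => hIJ _ <| (Submodule.Quotient.mk_eq_zero _).2 <| left_mem_cosetSpace ?_⟩
  simpa using mul_mem_leftIdeal 1 hx

theorem entry_eq_zero_of_mem_leftIdeal {I : Ideal Γ} {v : fiber F B}
    (hv : ∀ x ∈ I, entry F B B x v = 0) {a : A} (ha : a ∈ leftIdeal Γ I) :
    entry F B C a v = 0 := by
  suffices ∀ b, entry F B C (b * a) v = 0 by simpa using this 1
  induction ha using Submodule.span_induction with
  | mem x hx =>
    obtain ⟨x, hx, rfl⟩ := hx
    intro b
    refine (entry_mul_coe F b x v).trans ?_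
    rw [hv x hx, map_zero]
  | zero => intro b; rw [mul_zero, entry_zero hF]; rfl
  | add x y _ _ hx hy =>
    intro b
    rw [mul_add, entry_add hF, LinearMap.add_apply, hx, hy, add_zero]
  | smul a x _ hx =>
    intro b
    rw [smul_eq_mul, ← mul_assoc, hx]

/-- The vector `a v` in `F(C)` is killed by a product from `C`, like every vector there, and by a
product from `P`, as `a` is a representative for `P`; the two are comaximal. -/
theorem entry_eq_zero_of_leftRep {P : Blocks r} {I : Ideal Γ} {v : fiber F B}
    (hv : ∀ x ∈ I, entry F B B x v = 0) {a : A} (ha : LeftRep r I P a) (hP : C ≠ P) :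
    entry F B C a v = 0 := by
  obtain ⟨J, hJ⟩ := exists_entry_eq_zero hF (entry F B C a v)
  obtain ⟨K, hK, hKa⟩ := leftRep_iff.1 ha
  obtain ⟨x, hx, y, hy, e⟩ := words_comaximal hP J.2 hK
  have e' : a = (x : A) * a + (y : A) * a := by
    rw [← add_mul, ← Subalgebra.coe_add, e, Subalgebra.coe_one, one_mul]
  rw [e', entry_add hF, LinearMap.add_apply, entry_coe_mul, hJ x hx,
    entry_eq_zero_of_mem_leftIdeal hF hv (hKa y hy), add_zero]

theorem finite_setOf_entry_ne_zero (a : A) (v : fiber F B) : {C | entry F B C a v ≠ 0}.Finite := by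
  obtain ⟨I, hI⟩ := exists_entry_eq_zero hF v
  induction a using leftRep_induction h I with
  | mem a ha =>
    convert Set.finite_empty
    exact Set.eq_empty_of_forall_notMem fun C hC =>
      hC (entry_eq_zero_of_mem_leftIdeal hF hI ha)
  | rep P a ha =>
    refine (Set.finite_singleton P).subset fun C hC => ?_
    by_contra hP
    exact hC (entry_eq_zero_of_leftRep hF hI ha hP)
  | add a a' ha ha' =>
    refine (ha.union ha').subset fun C hC => ?_
    by_contra hc
    simp only [Set.mem_union, Set.mem_ofPred_eq, not_or, not_not] at hc
    refine hC ?_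
    rw [entry_add hF, LinearMap.add_apply, hc.1, hc.2, add_zero]

/-- The image of `b a` in `𝒜(B, D)` acts as the composition of the images of `a` and `b`, if
`a + A𝔪 ∈ (A/A𝔪)(C)` for a small enough `𝔪`. -/
theorem entry_mul_of_leftRep {I : words r B} {L : words r D}
    {v : fiber F B} (hIL : ∀ α : limHom r B D, α.1 I L = 0 → fiberMap F α v = 0) {a : A}
    (ha : LeftRep r I.1 C a) (b : A) :
    entry F B D (b * a) v = entry F C D b (entry F B C a v) := by
  have e := hIL (limComp h (ofElement r B C a) (ofElement r C D b) - ofElement r B D (b * a))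
    (sub_eq_zero.2 (limComp_ofElement_apply h ha b L))
  rw [fiberMap_sub hF, LinearMap.sub_apply, fiberMap_limComp, sub_eq_zero] at e
  exact e.symm

/-- The vector with components `(a v)_C`, for `v` in the fibre at `B`. -/
noncomputable def columnVector (a : A) (v : fiber F B) :
    DirectSum (Blocks r) fun C => fiber F C :=
  open Classical in
  DirectSum.mk (fun C => fiber F C) (finite_setOf_entry_ne_zero hF a v).toFinset
    fun C => entry F B C.1 a v

theorem columnVector_apply (a : A) (v : fiber F B) (C : Blocks r) :
    columnVector hF a v C = entry F B C a v := by
  classical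
  by_cases hC : entry F B C a v = 0
  · rw [hC]
    exact DirectSum.mk_apply_of_notMem (by simpa using hC)
  · exact DirectSum.mk_apply_of_mem (by simpa using hC)

/-- The operator of an element of `A` on the sum of the fibres. -/
noncomputable def sumAct (a : A) :
    (DirectSum (Blocks r) fun C => fiber F C) →+ DirectSum (Blocks r) fun C => fiber F C :=
  open Classical in
  DirectSum.toAddMonoid fun B =>
    { toFun := columnVector (B := B) hF a
      map_zero' := DFinsupp.ext fun C =>
        (columnVector_apply hF a 0 C).trans (map_zero (entry F B C a))
      map_add' v v' := DFinsupp.ext fun C => by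
        refine (columnVector_apply hF a (v + v') C).trans ?_
        rw [map_add, ← columnVector_apply hF, ← columnVector_apply hF]
        rfl }

open Classical in
theorem sumAct_of (a : A) (v : fiber F B) :
    sumAct hF a (DirectSum.of (fun C => fiber F C) B v) = columnVector hF a v :=
  DirectSum.toAddMonoid_of _ _ _

open Classical in
theorem sumAct_of_apply (a : A) (v : fiber F B) :
    sumAct hF a (DirectSum.of (fun C => fiber F C) B v) C = entry F B C a v := by
  rw [sumAct_of, columnVector_apply]

theorem sumAct_add (a b : A) : sumAct hF (a + b) = sumAct hF a + sumAct hF b := by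
  classical
  refine DirectSum.addHom_ext fun B v => DFinsupp.ext fun C => ?_
  rw [AddMonoidHom.add_apply]
  refine (sumAct_of_apply hF _ v).trans ?_
  rw [entry_add hF, LinearMap.add_apply, ← sumAct_of_apply hF a v, ← sumAct_of_apply hF b v]
  rfl

theorem sumAct_one : sumAct hF 1 = AddMonoidHom.id _ := by
  classical
  refine DirectSum.addHom_ext fun B v => DFinsupp.ext fun C => ?_
  refine (sumAct_of_apply hF _ v).trans ?_
  by_cases hC : C = B
  · subst hC
    exact (entry_one F v).trans (DirectSum.of_eq_same (β := fun C => fiber F C) C v).symm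
  · have := entry_coe_of_ne hF hC 1
    rw [Subalgebra.coe_one] at this
    rw [this]
    exact (DirectSum.of_eq_of_ne (β := fun C => fiber F C) B C v hC).symm

/-- Modulo `A𝔪`, with `𝔪` killing `v`, `a` may be taken to represent a single block `C`. Its column
at `v` is then concentrated at `C`, and the matrix product reduces to one composition in `𝒜`. -/
theorem sumAct_mul (a b : A) : sumAct hF (b * a) = (sumAct hF b).comp (sumAct hF a) := by
  classical
  refine DirectSum.addHom_ext fun B v => DFinsupp.ext fun D => ?_
  refine (sumAct_of_apply hF _ v).trans ?_
  obtain ⟨I₁, hI₁⟩ := exists_entry_eq_zero hF v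
  obtain ⟨I₂, L, hIL⟩ := exists_fiberMap_eq_zero hF D v
  -- The product must both kill `v` and be small enough that `α_{𝔪,𝔩}` determines `α v` in `F(D)`.
  obtain ⟨I, hI, h₁, h₂⟩ := words_directed I₁.2 I₂.2
  replace hI₁ : ∀ x ∈ I, entry F B B x v = 0 := fun x hx => hI₁ x (h₁ hx)
  replace hIL : ∀ α : limHom r B D, α.1 ⟨I, hI⟩ L = 0 → fiberMap F α v = 0 :=
    fun α hα => hIL α (limHom_eq_zero_of_le h₂ le_rfl hα)
  rw [AddMonoidHom.comp_apply]
  induction a using leftRep_induction h ⟨I, hI⟩ with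
  | mem a ha =>
    have e : sumAct hF a (DirectSum.of (fun C => fiber F C) B v) = 0 :=
      DFinsupp.ext fun C => (sumAct_of_apply hF a v).trans
        (entry_eq_zero_of_mem_leftIdeal hF hI₁ ha)
    rw [e, map_zero]
    exact entry_eq_zero_of_mem_leftIdeal hF hI₁ ((leftIdeal Γ I).smul_mem b ha)
  | rep C a ha =>
    have e : sumAct hF a (DirectSum.of (fun C => fiber F C) B v) =
        DirectSum.of (fun C => fiber F C) C (entry F B C a v) := by
      refine DFinsupp.ext fun P => (sumAct_of_apply hF a v).trans ?_
      by_cases hP : P = C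
      · subst hP
        exact (DirectSum.of_eq_same (β := fun C => fiber F C) P _).symm
      · rw [entry_eq_zero_of_leftRep hF hI₁ ha hP]
        exact (DirectSum.of_eq_of_ne (β := fun C => fiber F C) C P _ hP).symm
    rw [e, sumAct_of_apply, entry_mul_of_leftRep hF hIL ha]
  | add a a' ha ha' =>
    rw [mul_add, entry_add hF, LinearMap.add_apply, ha, ha', sumAct_add, AddMonoidHom.add_apply,
      map_add]
    rfl

/-- The direct sum of the fibres of a profinite `𝒜`-module. -/
def BlockSum (_ : IsProfinite h F) : Type (max v w) :=
  DirectSum (Blocks r) fun B => fiber F B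

noncomputable instance : AddCommGroup (BlockSum hF) :=
  inferInstanceAs (AddCommGroup (DirectSum (Blocks r) fun B => fiber F B))

noncomputable instance : Module A (BlockSum hF) where
  smul a u := sumAct hF a u
  one_smul u := DFunLike.congr_fun (sumAct_one hF) u
  mul_smul b a u := DFunLike.congr_fun (sumAct_mul hF a b) u
  smul_zero a := map_zero (sumAct hF a)
  smul_add a := map_add (sumAct hF a)
  add_smul a b u := DFunLike.congr_fun (sumAct_add hF a b) u
  zero_smul u := by
    have e : sumAct hF 0 + sumAct hF 0 = sumAct hF 0 := by rw [← sumAct_add, add_zero]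
    exact DFunLike.congr_fun (add_eq_left.1 e) u

open Classical in
/-- The inclusion of a fibre into the sum of the fibres. -/
noncomputable def toBlockSum (B : Blocks r) : fiber F B →+ BlockSum hF :=
  DirectSum.of (fun C => fiber F C) B

/-- The components of an element of the sum of the fibres. -/
def component (B : Blocks r) : BlockSum hF →+ fiber F B where
  toFun u := (show DirectSum (Blocks r) fun B => fiber F B from u) B
  map_zero' := rfl
  map_add' _ _ := rfl

variable {hF}

@[ext]
theorem BlockSum.ext {u u' : BlockSum hF} (huu : ∀ B, component hF B u = component hF B u') :
    u = u' :=
  DFinsupp.ext huu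

theorem BlockSum.induction {p : BlockSum hF → Prop} (u : BlockSum hF) (zero : p 0)
    (mem : ∀ B (v : fiber F B), p (toBlockSum hF B v)) (add : ∀ u u', p u → p u' → p (u + u')) :
    p u := by
  classical
  exact DirectSum.induction_on u zero mem add

theorem component_toBlockSum (v : fiber F B) : component hF B (toBlockSum hF B v) = v := by
  classical
  exact DirectSum.of_eq_same (β := fun C => fiber F C) B v

theorem component_toBlockSum_of_ne (hBC : C ≠ B) (v : fiber F B) :
    component hF C (toBlockSum hF B v) = 0 := by
  classical
  exact DirectSum.of_eq_of_ne (β := fun C => fiber F C) B C v hBC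

theorem component_smul_toBlockSum (a : A) (v : fiber F B) :
    component hF C (a • toBlockSum hF B v) = entry F B C a v :=
  sumAct_of_apply hF a v

theorem component_coe_smul (x : Γ) (u : BlockSum hF) :
    component hF C (x • u) = entry F C C x (component hF C u) := by
  induction u using BlockSum.induction with
  | zero => rw [smul_zero, map_zero, map_zero]
  | mem B v =>
    refine (component_smul_toBlockSum (x : A) v).trans ?_
    by_cases hC : C = B
    · subst hC
      rw [component_toBlockSum]
    · rw [component_toBlockSum_of_ne hC, map_zero, entry_coe_of_ne hF hC]
      rfl
  | add u u' hu hu' => rw [smul_add, map_add, hu, hu', map_add, map_add]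

theorem toBlockSum_mem_blockSpace (v : fiber F B) :
    toBlockSum hF B v ∈ blockSpace r (BlockSum hF) B := by
  obtain ⟨I, hI⟩ := exists_entry_eq_zero hF v
  refine ⟨I.1, I.2, fun x hx => BlockSum.ext fun C => ?_⟩
  rw [component_coe_smul, map_zero]
  by_cases hC : C = B
  · subst hC
    rw [component_toBlockSum, hI x hx]
  · rw [component_toBlockSum_of_ne hC, map_zero]

/-- A component of `u` at `C ≠ B` is killed by a product from `B` and by one from `C`, which are
comaximal. So the block spaces are no larger than the fibres. -/
theorem toBlockSum_component {u : BlockSum hF} (hu : u ∈ blockSpace r (BlockSum hF) B) :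
    toBlockSum hF B (component hF B u) = u := by
  refine BlockSum.ext fun C => ?_
  by_cases hC : C = B
  · subst hC
    rw [component_toBlockSum]
  · rw [component_toBlockSum_of_ne hC]
    obtain ⟨I, hI, hIu⟩ := hu
    obtain ⟨J, hJ⟩ := exists_entry_eq_zero hF (component hF C u)
    obtain ⟨x, hx, y, hy, e⟩ := words_comaximal hC J.2 hI
    have e₁ : entry F C C ((x : A) + (y : A)) (component hF C u) = component hF C u := by
      rw [← Subalgebra.coe_add, e, Subalgebra.coe_one, entry_one]
    rw [← e₁, entry_add hF, LinearMap.add_apply, hJ x hx, ← component_coe_smul, hIu y hy,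
      map_zero, add_zero]

theorem isBlockModule_blockSum : IsBlockModule r (BlockSum hF) := by
  rw [isBlockModule_iff, eq_top_iff]
  rintro u -
  induction u using BlockSum.induction with
  | zero => exact zero_mem _
  | mem B v => exact Submodule.mem_iSup_of_mem B (toBlockSum_mem_blockSpace v)
  | add u u' hu hu' => exact add_mem hu hu'

/-- The action of `𝒜` on the block spaces of the sum of the fibres is the original one. -/
theorem component_eq_of_isActAt {α : limHom r B C} {u z : BlockSum hF}
    (hu : u ∈ blockSpace r (BlockSum hF) B) (hz : IsActAt α u z) :
    component hF C z = fiberMap F α (component hF B u) := by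
  obtain ⟨I₁, hI₁, h₁⟩ := id hu
  obtain ⟨I₂, J₂, h₂⟩ := exists_fiberMap_eq_zero hF C (component hF B u)
  obtain ⟨I, hI, hle₁, hle₂⟩ := words_directed hI₁ I₂.2
  obtain ⟨J, a, hle, -, ha, -, rfl⟩ :=
    hz.exists_le h (I₀ := ⟨I, hI⟩) J₂ fun x hx => h₁ x (hle₁ hx)
  -- `α` and the image of `a` agree in the component that controls the action on this vector.
  have e := h₂ (α - ofElement r B C a)
    (sub_eq_zero.2 (limHom_factor α hle₂ hle ha))
  rw [fiberMap_sub hF, LinearMap.sub_apply, sub_eq_zero] at e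
  rw [e, ← toBlockSum_component hu, component_smul_toBlockSum, component_toBlockSum]
  rfl

/-- The scalar action that the sum inherits from `A` is the original one on each fibre, so the
identification of block spaces with fibres is `k`-linear. -/
theorem component_algebraMap_smul (c : k) (u : BlockSum hF) :
    component hF C (algebraMap k A c • u) = c • component hF C u := by
  have e := component_coe_smul (C := C) (algebraMap k Γ c) u
  have e' : ((algebraMap k Γ c : Γ) : A) = c • 1 := Algebra.algebraMap_eq_smul_one c
  rw [e', entry_smul hF, LinearMap.smul_apply, entry_one] at e
  exact e

end Entries
-- The two equivalences.
section Equivalence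

variable {k : Type u} [Field k] {A : Type v} [Ring A] [Algebra k A] {Γ : Subalgebra k A}
  {r : Setoid (Cfs k Γ)} {h : IsStrongHCBlockSubalgebra Γ r}

open scoped ModuleCat.Algebra

/-- The direct sum of the fibres, as an object of the category of `A`-modules. -/
noncomputable def blockSumModule {F : BlockCat Γ r h ⥤ ModuleCat.{w} k} (hF : IsProfinite h F) :
    ModuleCat.{max v w} A :=
  ModuleCat.of A (BlockSum hF)

/-- The block space at `B` of the sum of the fibres is the fibre at `B`. -/
noncomputable def blockSpaceBlockSumEquiv {F : BlockCat Γ r h ⥤ ModuleCat.{max v w} k}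
    (hF : IsProfinite h F) (B : Blocks r) :
    blockSpace r (blockSumModule hF) B ≃ₗ[k] fiber F B where
  toFun u := component hF B u.1
  invFun v := ⟨toBlockSum hF B v, toBlockSum_mem_blockSpace v⟩
  map_add' u u' := map_add (component hF B) u.1 u'.1
  map_smul' c u := component_algebraMap_smul c u.1
  left_inv u := Subtype.ext (toBlockSum_component u.2)
  right_inv v := component_toBlockSum v

/-- A profinite `𝒜`-module is recovered from the sum of its fibres. -/
noncomputable def blockFunctorBlockSumIso {F : BlockCat Γ r h ⥤ ModuleCat.{max v w} k}
    (hF : IsProfinite h F) : blockFunctor h (blockSumModule hF) ≅ F :=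
  NatIso.ofComponents
    (fun B => LinearEquiv.toModuleIso (X₂ := F.obj B)
      (blockSpaceBlockSumEquiv hF (show Blocks r from B)))
    fun {B C} α => ModuleCat.hom_ext <| LinearMap.ext fun u =>
      component_eq_of_isActAt u.2 (blockAct_isActAt h (show limHom r B C from α) u)

variable (h) in
/-- The functor from `HC(A; Γ, ∼)` to the profinite `𝒜`-modules. -/
noncomputable def profiniteFunctor : HC.{u, v, w} Γ r ⥤ ProfiniteMod.{u, v, w} h :=
  (IsProfinite h).lift (ObjectProperty.ι _ ⋙ blockSpacesFunctor h) fun V =>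
    isProfinite_blockFunctor h V.obj

variable (h) in
/-- The functor from `SHC(A; Γ, ∼)` to the discrete `𝒜`-modules. -/
noncomputable def discreteFunctor : SHC.{u, v, w} Γ r ⥤ DiscreteMod.{u, v, w} h :=
  (IsDiscrete h).lift (ObjectProperty.ι _ ⋙ blockSpacesFunctor h) fun V =>
    isDiscrete_blockFunctor h V.property

theorem full_ι_comp_blockSpacesFunctor {P : ObjectProperty (ModuleCat.{w} A)}
    (hP : ∀ V, P V → IsBlockModule r V) : (P.ι ⋙ blockSpacesFunctor h).Full where
  map_surjective {V _} η := by
    obtain ⟨f, hf⟩ := blockSpacesFunctor_map_surjective h (hP _ V.property) η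
    exact ⟨ObjectProperty.homMk f, hf⟩

theorem faithful_ι_comp_blockSpacesFunctor {P : ObjectProperty (ModuleCat.{w} A)}
    (hP : ∀ V, P V → IsBlockModule r V) : (P.ι ⋙ blockSpacesFunctor h).Faithful where
  map_injective {V _} _ _ hfg :=
    ObjectProperty.hom_ext _ (blockSpacesFunctor_map_injective h (hP _ V.property) hfg)

theorem IsDiscrete.of_iso {F F' : BlockCat Γ r h ⥤ ModuleCat.{w} k} (e : F ≅ F')
    (hl : ∀ B C : BlockCat Γ r h, IsLinearMap k (functorMap F' B C)) (hF : IsDiscrete h F) :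
    IsDiscrete h F' := by
  rw [isDiscrete_iff] at hF ⊢
  refine fun (B C : BlockCat Γ r h) => ⟨hl B C, ?_⟩
  obtain ⟨-, I, J, hIJ⟩ := hF B C
  refine ⟨I, J, fun α hα => LinearMap.ext fun v => ?_⟩
  have e₁ : functorMap F' B C α v = (e.hom.app (C : BlockCat Γ r h)).hom
      (functorMap F B C α ((e.inv.app (B : BlockCat Γ r h)).hom v)) := by
    have := LinearMap.congr_fun (congrArg ModuleCat.Hom.hom (NatIso.naturality_1 e
      (X := (B : BlockCat Γ r h)) (Y := (C : BlockCat Γ r h)) α)) v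
    exact this.symm
  rw [e₁, hIJ α hα, LinearMap.zero_apply, map_zero]
  rfl

/-- The universe is `max v w` because the inverse construction sums over the blocks, which live in
`Type v`. -/
theorem isEquivalence_profiniteFunctor :
    (profiniteFunctor.{u, v, max v w} h).IsEquivalence where
  faithful := by
    have := faithful_ι_comp_blockSpacesFunctor (h := h)
      (P := fun V : ModuleCat.{max v w} A => IsBlockModule r V) fun _ => id
    exact Functor.Faithful.of_comp_iso ((IsProfinite h).liftCompιIso _ _)
  full := by
    have := full_ι_comp_blockSpacesFunctor (h := h)
      (P := fun V : ModuleCat.{max v w} A => IsBlockModule r V) fun _ => id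
    exact Functor.Full.of_comp_faithful_iso ((IsProfinite h).liftCompιIso _ _)
  essSurj.mem_essImage F :=
    ⟨⟨blockSumModule F.property, isBlockModule_blockSum⟩,
      ⟨ObjectProperty.isoMk _ (blockFunctorBlockSumIso.{u, v, w} F.property)⟩⟩

theorem isEquivalence_discreteFunctor :
    (discreteFunctor.{u, v, max v w} h).IsEquivalence where
  faithful := by
    have := faithful_ι_comp_blockSpacesFunctor (h := h)
      (P := fun V : ModuleCat.{max v w} A => IsStrongBlockModule r V) fun _ hV => hV.1
    exact Functor.Faithful.of_comp_iso ((IsDiscrete h).liftCompιIso _ _)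
  full := by
    have := full_ι_comp_blockSpacesFunctor (h := h)
      (P := fun V : ModuleCat.{max v w} A => IsStrongBlockModule r V) fun _ hV => hV.1
    exact Functor.Full.of_comp_faithful_iso ((IsDiscrete h).liftCompιIso _ _)
  essSurj.mem_essImage F := by
    -- Discreteness passes along this isomorphism to the functor of the sum of the fibres, which
    -- makes that block module strong.
    let e := blockFunctorBlockSumIso.{u, v, w} F.property.isProfinite
    exact ⟨⟨blockSumModule F.property.isProfinite,
      isStrongBlockModule_of_isDiscrete h isBlockModule_blockSum
        (F.property.of_iso e.symm (isLinearMap_functorMap_blockFunctor h _))⟩,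
      ⟨ObjectProperty.isoMk _ e⟩⟩

end Equivalence
end HarishChandra

theorem mainTheorem2 {k : Type u} [Field k] {A : Type v} [Ring A] [Algebra k A]
    (Γ : Subalgebra k A) (r : Setoid (HarishChandra.Cfs k Γ))
    (h : HarishChandra.IsStrongHCBlockSubalgebra Γ r) :
    Nonempty (HarishChandra.ProfiniteMod.{u, v, max v w} h ≌
        HarishChandra.HC.{u, v, max v w} Γ r) ∧
      Nonempty (HarishChandra.DiscreteMod.{u, v, max v w} h ≌
        HarishChandra.SHC.{u, v, max v w} Γ r) := by
  have := HarishChandra.isEquivalence_profiniteFunctor.{u, v, w} (h := h)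
  have := HarishChandra.isEquivalence_discreteFunctor.{u, v, w} (h := h)
  exact ⟨⟨(HarishChandra.profiniteFunctor.{u, v, max v w} h).asEquivalence.symm⟩,
    ⟨(HarishChandra.discreteFunctor.{u, v, max v w} h).asEquivalence.symm⟩⟩
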